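/- Let $F_2=\langle x,y\mid-\rangle$ be the free group on $x,y$, and write $\overline{u}=u^{-1}$. An element $u\in F_2$ is \emph{primitive} if there is $v\in F_2$ such that $\{u,v\}$ is a basis of $F_2$, and it is a \emph{power} if $u=w^k$ for some nontrivial $w\in F_2$ and some integer $k\ge 2$. For integers $n,p,q$ put \[c_0'(n,p,q)=x^p\,(x^{p+1}yx^py^{q+1}x^py)^n,\] \[c_0''(n,p,q)=x^pyxy\,(\overline{y}x^pyx^py^qx^pyx^p\overline{y}\,\overline{x}^{\,p})^n,\] \[c_1'(n,p,q)=y\overline{x}^{\,p}\overline{y}\,\overline{x}^{\,p}\overline{y}^{\,q}\,(y^{q+1}x^pyx^{p+1}yx^p)^n,\] \[c_1''(n,p,q)=\overline{y}^{\,q}\overline{x}^{\,p}\overline{y}\,\overline{x}^{\,p}\,(x^pyx^py^qx^pyx^p\overline{y}\,\overline{x}^{\,p}\overline{y})^n.\] Let $n,p,q$ be integers with $p\neq 0$. In the lists below, a letter $n$, $p$ or $q$ inside a triple means that this entry is arbitrary (subject to $p\ne0$). (a) $c_0'(n,p,q)$ is primitive if and only if $(n,p,q)$ is $(0,\pm1,q)$,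 $(1,-2,0)$, $(1,-1,1)$, $(1,p,-1)$, $(-1,2,0)$, $(-1,1,1)$, $(2,-1,0)$, $(-2,1,0)$ or $(n,1,-1)$. It is a power if and only if $(n,p,q)$ is $(0,p,q)$ with $|p|\ge2$, $(1,-1,0)$ or $(-1,1,0)$. (b) $c_0''(n,p,q)$ is primitive if and only if $(n,p,q)$ is $(0,2,q)$, $(1,p,0)$, $(1,-1,2)$ or $(1,-2,1)$. It is a power if and only if $(n,p,q)$ is $(0,1,q)$ or $(1,-1,1)$. (c) $c_1'(n,p,q)$ is primitive if and only if $(n,p,q)$ is $(0,p,1)$, $(0,\pm1,3)$, $(-1,2,0)$, $(-1,-1,2)$ or $(-1,p,1)$. It is a power if and only if $(n,p,q)$ is $(-1,1,0)$ or $(0,p,2)$. (d) $c_1''(n,p,q)$ is primitive if and only if $(n,p,q)$ is $(0,\pm1,2)$ or $(0,p,0)$. It is a power if and only if $(n,p,q)$ is $(0,p,1)$. -/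

import Mathlib

namespace KleinWords

/-- The free group of rank two with basis `x`, `y`. -/
abbrev F₂ : Type := FreeGroup (Fin 2)

/-- The first generator of `F₂`. -/
def x : F₂ := FreeGroup.of 0

/-- The second generator of `F₂`. -/
def y : F₂ := FreeGroup.of 1

/-- `u` is primitive if there is `v` such that `{u, v}` is a basis of `F₂`. -/
def IsPrimitive (u : F₂) : Prop :=
  ∃ (v : F₂) (b : FreeGroupBasis (Fin 2) F₂), b 0 = u ∧ b 1 = v

/-- `u` is a power if `u = w ^ k` for some nontrivial `w` and some integer `k ≥ 2`. -/
def IsPower (u : F₂) : Prop :=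
  ∃ (w : F₂) (k : ℕ), w ≠ 1 ∧ 2 ≤ k ∧ u = w ^ k

/-- The word `c₀'(n,p,q)`. -/
def c₀' (n p q : ℤ) : F₂ :=
  x ^ p * (x ^ (p + 1) * y * x ^ p * y ^ (q + 1) * x ^ p * y) ^ n

/-- The word `c₀''(n,p,q)`. -/
def c₀'' (n p q : ℤ) : F₂ :=
  x ^ p * y * x * y *
    (y⁻¹ * x ^ p * y * x ^ p * y ^ q * x ^ p * y * x ^ p * y⁻¹ * x ^ (-p)) ^ n

/-- The word `c₁'(n,p,q)`. -/
def c₁' (n p q : ℤ) : F₂ :=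
  y * x ^ (-p) * y⁻¹ * x ^ (-p) * y ^ (-q) *
    (y ^ (q + 1) * x ^ p * y * x ^ (p + 1) * y * x ^ p) ^ n

/-- The word `c₁''(n,p,q)`. -/
def c₁'' (n p q : ℤ) : F₂ :=
  y ^ (-q) * x ^ (-p) * y⁻¹ * x ^ (-p) *
    (x ^ p * y * x ^ p * y ^ q * x ^ p * y * x ^ p * y⁻¹ * x ^ (-p) * y⁻¹) ^ n

end KleinWords

/-!
Let a colouring of the free group `F` be almost invariant, meaning that each right translation
changes it at finitely many elements only, and invariant under right multiplication by `u`. On a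
cone of reduced words with a long prefix `l` it is constant. Along an axis of a conjugate of `u`
it is almost constant, and the axis through `l` that makes a turn of `u` at `l` joins two of the
cones into which the cone of `l` decomposes. So if the Whitehead graph of `u` has no cut vertex,
descending induction on the length of `l` shows that the colouring is constant up to finitely many
elements. For `u` a member of a basis `b` with another member `v`, the colouring of `z` by whether
its reduced `b`-word begins with `v` is a counterexample, whence `u` is not primitive.

A cyclically reduced word that is a `k`-th power is a `k`-fold repetition, so for every weight
function on the syllables `x ^ a * y ^ b` the total weight of the word is divisible by `k`. A
weight with total `1` shows that the word is not a power.

Up to conjugation and inversion, each member of the four families with `n ≠ 0` is an explicit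
cyclic word in a suitable basis. Outside the listed cases its Whitehead graph has no cut vertex and
some weight has total `1`; in the listed ones it is visibly primitive or a power.
-/

namespace KleinWords

open FreeGroup hiding map_mul map_one map_inv
open Filter

section Whitehead

variable {α : Type*}

/-- A letter of `FreeGroup α`: a generator or the inverse of one. -/
abbrev Letter (α : Type*) : Type _ := α × Bool

/-- The letter inverse to `s`. -/
def bar (s : Letter α) : Letter α := (s.1, !s.2)

/-- Some cyclic conjugate of `u` is a cyclically reduced word ending in `s` and beginning with `t`;
that is, `s` and `t` are consecutive in `u` read cyclically. -/
def HasTurn (u : FreeGroup α) (s t : Letter α) : Prop :=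
  ∃ M : List (Letter α), M.head? = some t ∧ M.getLast? = some s ∧
    IsCyclicallyReduced M ∧ IsConj (mk M) u

/-- The Whitehead graph of `u`, in which each turn `s`, `t` of `u` is an edge from `bar s` to `t`,
stays connected when any vertex `r` is removed. Connectedness is expressed by saying that a
two-colouring which agrees along edges is constant. -/
def NoCutVertex (u : FreeGroup α) : Prop :=
  ∀ (r : Letter α) (f : Letter α → Bool),
    (∀ s t, s ≠ r → t ≠ r → HasTurn u (bar s) t → f s = f t) → ∀ s t, s ≠ r → t ≠ r → f s = f t

/-- A colouring of a group which each right translation changes at finitely many elements only. -/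
def AlmostInvariant {G κ : Type*} [Group G] (χ : G → κ) : Prop :=
  ∀ w, ∀ᶠ z in cofinite, χ (z * w) = χ z

/-- All but finitely many elements of `S` have colour `c`. -/
def AlmostConstantOn {G κ : Type*} (χ : G → κ) (S : Set G) (c : κ) : Prop :=
  ∀ᶠ z in cofinite, z ∈ S → χ z = c

@[simp]
theorem bar_bar (s : Letter α) : bar (bar s) = s := by simp [bar]

theorem mk_singleton_bar (s : Letter α) : mk [bar s] = (mk [s])⁻¹ := by
  simp [inv_mk, invRev, bar]

theorem isReduced_append_singleton_iff {l : List (Letter α)} {a : Letter α}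
    (hl : IsReduced (l ++ [a])) (t : Letter α) : IsReduced (l ++ [a] ++ [t]) ↔ t ≠ bar a := by
  have hturn : (a.1 = t.1 → a.2 = t.2) ↔ t ≠ bar a := by
    obtain ⟨i, b⟩ := a
    obtain ⟨j, c⟩ := t
    cases b <;> cases c <;> simp [bar, eq_comm]
  unfold FreeGroup.IsReduced at hl ⊢
  rw [List.isChain_append, ← hturn]
  simp [hl]

theorem exists_forbidden_letter [Nontrivial α] {l : List (Letter α)} (hl : IsReduced l)
    {s t : Letter α} (hs : IsReduced (l ++ [s])) (ht : IsReduced (l ++ [t])) :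
    ∃ r, s ≠ r ∧ t ≠ r ∧ ∀ a, a ≠ r → IsReduced (l ++ [a]) := by
  rcases List.eq_nil_or_concat' l with rfl | ⟨l, a, rfl⟩
  · obtain ⟨i, hi⟩ := exists_ne s.1
    by_cases hit : t = (i, true)
    · exact ⟨(i, false), fun h => hi (by rw [h]), by simp [hit], by simp⟩
    · exact ⟨(i, true), fun h => hi (by rw [h]), hit, by simp⟩
  · simp only [isReduced_append_singleton_iff hl] at hs ht ⊢
    exact ⟨bar a, hs, ht, fun _ => id⟩

theorem isCyclicallyReduced_invRev {M : List (Letter α)} (hM : IsCyclicallyReduced M) :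
    IsCyclicallyReduced (invRev M) := by
  refine ⟨?_, fun a ha b hb hab => ?_⟩
  · classical rw [isReduced_iff_reduce_eq, reduce_invRev, hM.isReduced.reduce_eq]
  · simp only [invRev, Option.mem_def, List.getLast?_reverse, List.head?_reverse, List.head?_map,
      List.getLast?_map, Option.map_eq_some_iff] at ha hb
    obtain ⟨a, ha, rfl⟩ := ha
    obtain ⟨b, hb, rfl⟩ := hb
    simpa using (hM.2 b hb a ha hab.symm).symm

theorem tendsto_mul_zpow_cofinite (g : FreeGroup α) {v : FreeGroup α} (hv : v ≠ 1) :
    Tendsto (fun k : ℤ => g * v ^ k) cofinite cofinite :=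
  ((mul_right_injective g).comp <| injective_zpow_iff_not_isOfFinOrder.2 <|
    not_isOfFinOrder_of_isMulTorsionFree hv).tendsto_cofinite

theorem exists_ne_zero_of_eventually_cofinite {P : ℤ → Prop} (h : ∀ᶠ k in cofinite, P k) :
    ∃ k : ℕ, k ≠ 0 ∧ P k ∧ P (-k) := by
  have hpos : ∀ᶠ k : ℕ in cofinite, P k := Nat.cast_injective.tendsto_cofinite.eventually h
  have hneg : ∀ᶠ k : ℕ in cofinite, P (-k) :=
    (neg_injective.comp Nat.cast_injective).tendsto_cofinite.eventually h
  exact ((Set.finite_singleton 0).eventually_cofinite_notMem.and (hpos.and hneg)).exists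

theorem AlmostInvariant.of_generators {κ : Type*} {χ : FreeGroup α → κ}
    (h : ∀ i, ∀ᶠ z in cofinite, χ (z * of i) = χ z) : AlmostInvariant χ := by
  have hinv : ∀ w, (∀ᶠ z in cofinite, χ (z * w) = χ z) →
      ∀ᶠ z in cofinite, χ (z * w⁻¹) = χ z := by
    intro w hw
    filter_upwards [(mul_left_injective w⁻¹).tendsto_cofinite.eventually hw] with z hz
    rw [← hz, inv_mul_cancel_right]
  intro w
  induction w using FreeGroup.induction_on with
  | C1 => simp
  | of i => exact h i
  | inv_of i hi => exact hinv _ hi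
  | mul v w hv hw =>
    filter_upwards [hv, (mul_left_injective v).tendsto_cofinite.eventually hw] with z hzv hzw
    rw [← mul_assoc, hzw, hzv]

theorem AlmostInvariant.eventually_mul_zpow_eq {κ : Type*} {χ : FreeGroup α → κ}
    (hχ : AlmostInvariant χ) {u v : FreeGroup α} (hu : ∀ z, χ (z * u) = χ z) (hv : v ≠ 1)
    (huv : IsConj v u) (g : FreeGroup α) :
    ∃ c, ∀ᶠ k : ℤ in cofinite, χ (g * v ^ k) = c := by
  obtain ⟨d, rfl⟩ := isConj_iff.1 huv
  have hzpow : ∀ (k : ℤ) z, χ (z * (d * v * d⁻¹) ^ k) = χ z := by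
    intro k
    induction k with
    | zero => simp
    | succ k ih => intro z; rw [zpow_add_one, ← mul_assoc, hu, ih]
    | pred k ih => intro z; rw [← hu, mul_assoc, ← zpow_add_one, sub_add_cancel, ih]
  refine ⟨χ (g * d⁻¹), ?_⟩
  filter_upwards [(tendsto_mul_zpow_cofinite g hv).eventually (hχ d⁻¹)] with k hk
  rw [← hk, ← hzpow k (g * d⁻¹), conj_zpow]
  congr 1
  group

theorem mk_ne_one {M : List (Letter α)} (hM : IsReduced M) (h : M ≠ []) : mk M ≠ 1 := by
  classical
  intro h1
  rw [← hM.reduce_eq, ← toWord_mk, h1, toWord_one] at h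
  exact h rfl

section Cones

variable [DecidableEq α]

/-- The elements whose reduced word begins with `l`. -/
def cone (l : List (Letter α)) : Set (FreeGroup α) := {z | l <+: z.toWord}

theorem mul_pow_mem_cone {l M : List (Letter α)} {t : Letter α} (hl : IsReduced (l ++ [t]))
    (hM : IsCyclicallyReduced M) (ht : M.head? = some t) {k : ℕ} (hk : k ≠ 0) :
    mk l * mk M ^ k ∈ cone (l ++ [t]) := by
  obtain ⟨M, rfl⟩ := List.head?_eq_some_iff.1 ht
  obtain ⟨k, rfl⟩ := Nat.exists_eq_succ_of_ne_zero hk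
  have hpow := (hM.flatten_replicate (k + 1)).isReduced
  rw [List.replicate_succ, List.flatten_cons, List.cons_append] at hpow
  have hword : IsReduced (l ++ [t] ++ (M ++ (List.replicate k (t :: M)).flatten)) :=
    IsReduced.append_overlap hl hpow (by simp)
  refine ⟨M ++ (List.replicate k (t :: M)).flatten, ?_⟩
  rw [← hword.reduce_eq, ← toWord_mk, pow_mk, mul_mk, Nat.succ_eq_add_one, List.replicate_succ]
  simp

theorem cone_subset (l : List (Letter α)) {z : FreeGroup α} (hz : z ∈ cone l) :
    z = mk l ∨ ∃ t, IsReduced (l ++ [t]) ∧ z ∈ cone (l ++ [t]) := by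
  obtain ⟨m, hm⟩ := hz
  cases m with
  | nil => exact .inl (by rw [← mk_toWord (x := z), ← hm, List.append_nil])
  | cons t m =>
    have hr : IsReduced (l ++ t :: m) := hm ▸ isReduced_toWord
    rw [List.append_cons] at hr hm
    exact .inr ⟨t, List.IsChain.left_of_append hr, m, hm⟩

theorem AlmostInvariant.exists_eq_on_cone {κ : Type*} [Finite α] {χ : FreeGroup α → κ}
    (hχ : AlmostInvariant χ) :
    ∃ N : ℕ, ∀ l, N ≤ l.length → ∀ z ∈ cone l, χ z = χ (mk l) := by
  have hfin : {z | ¬ ∀ s : Letter α, χ (z * mk [s]) = χ z}.Finite :=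
    eventually_all.2 fun s => hχ (mk [s])
  obtain ⟨N, hN⟩ := (hfin.image fun z => z.toWord.length).bddAbove
  have hstep : ∀ l, IsReduced l → N < l.length → ∀ s, χ (mk l * mk [s]) = χ (mk l) := by
    intro l hl hlen
    by_contra hc
    have : (mk l).toWord.length ≤ N := hN ⟨mk l, hc, rfl⟩
    rw [toWord_mk, hl.reduce_eq] at this
    omega
  refine ⟨N + 1, fun l hlen z ⟨m, hm⟩ => ?_⟩
  rw [← mk_toWord (x := z), ← hm]
  have hred : IsReduced (l ++ m) := hm ▸ isReduced_toWord
  clear hm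
  induction m using List.reverseRecOn with
  | nil => rw [List.append_nil]
  | append_singleton m s ih =>
    rw [← List.append_assoc] at hred ⊢
    have hlm : IsReduced (l ++ m) := List.IsChain.left_of_append hred
    rw [← mul_mk, hstep _ hlm (by rw [List.length_append]; omega), ih hlm]

/-- Along the axis of `u` through `mk l`, which runs from the cone of `l ++ [bar s]` to that of
`l ++ [t]`, a `u`-invariant colouring takes one colour almost everywhere. -/
theorem HasTurn.eq_of_almostConstantOn {κ : Type*} {χ : FreeGroup α → κ} {u : FreeGroup α}
    {s t : Letter α} (h : HasTurn u s t) (hχ : AlmostInvariant χ) (hu : ∀ z, χ (z * u) = χ z)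
    {l : List (Letter α)} (ht : IsReduced (l ++ [t])) (hs : IsReduced (l ++ [bar s])) {c d : κ}
    (hc : AlmostConstantOn χ (cone (l ++ [bar s])) c)
    (hd : AlmostConstantOn χ (cone (l ++ [t])) d) : c = d := by
  obtain ⟨M, hhead, hlast, hM, hconj⟩ := h
  have hM1 : mk M ≠ 1 := mk_ne_one hM.isReduced (by rintro rfl; simp at hhead)
  have haxis := tendsto_mul_zpow_cofinite (mk l) hM1
  obtain ⟨e, he⟩ := hχ.eventually_mul_zpow_eq hu hM1 hconj (mk l)
  obtain ⟨k, hk, ⟨ek, -, dk⟩, ek', ck, -⟩ := exists_ne_zero_of_eventually_cofinite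
    (he.and ((haxis.eventually hc).and (haxis.eventually hd)))
  have hpos : mk l * mk M ^ (k : ℤ) ∈ cone (l ++ [t]) := by
    rw [zpow_natCast]
    exact mul_pow_mem_cone ht hM hhead hk
  have hneg : mk l * mk M ^ (-k : ℤ) ∈ cone (l ++ [bar s]) := by
    rw [zpow_neg, ← inv_zpow, zpow_natCast, inv_mk]
    exact mul_pow_mem_cone hs (isCyclicallyReduced_invRev hM) (by simp [invRev, hlast, bar]) hk
  rw [← ck hneg, ← dk hpos, ek, ek']

theorem almostConstantOn_cone_of_extensions [Finite α] {κ : Type*} {χ : FreeGroup α → κ}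
    {l : List (Letter α)} {c : κ}
    (h : ∀ t, IsReduced (l ++ [t]) → AlmostConstantOn χ (cone (l ++ [t])) c) :
    AlmostConstantOn χ (cone l) c := by
  have hext : ∀ᶠ z in cofinite, ∀ t, IsReduced (l ++ [t]) → z ∈ cone (l ++ [t]) → χ z = c :=
    eventually_all.2 fun t => eventually_imp_distrib_left.2 (h t)
  filter_upwards [hext, (Set.finite_singleton (mk l)).eventually_cofinite_notMem] with z hz hne hzl
  obtain h1 | ⟨t, ht, hzt⟩ := cone_subset l hzl
  · exact absurd h1 hne
  · exact hz t ht hzt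

theorem head?_toWord_mul_mk_singleton {z : FreeGroup α} {s : Letter α} (h1 : z ≠ 1)
    (h2 : z * mk [s] ≠ 1) : (z * mk [s]).toWord.head? = z.toWord.head? := by
  obtain ⟨l, a, hz⟩ := (List.eq_nil_or_concat' z.toWord).resolve_left (toWord_eq_nil_iff.not.2 h1)
  have hla : IsReduced (l ++ [a]) := hz ▸ isReduced_toWord
  have hz' : z = mk l * mk [a] := by rw [mul_mk, ← hz, mk_toWord]
  by_cases hs : s = bar a
  · have hzs : z * mk [s] = mk l := by rw [hs, mk_singleton_bar, hz', mul_inv_cancel_right]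
    have hl : IsReduced l := List.IsChain.left_of_append hla
    have hne : l ≠ [] := by rintro rfl; exact h2 hzs
    rw [hzs, hz, toWord_mk, hl.reduce_eq, List.head?_append_of_ne_nil _ hne]
  · have hred := (isReduced_append_singleton_iff hla s).2 hs
    rw [hz', mul_mk, mul_mk, toWord_mk, toWord_mk, hred.reduce_eq, hla.reduce_eq,
      List.head?_append_of_ne_nil (l ++ [a]) (by simp)]

theorem almostInvariant_head?_toWord :
    AlmostInvariant fun z : FreeGroup α => z.toWord.head? := by
  refine .of_generators fun i => ?_
  filter_upwards [(Set.toFinite {1, (of i)⁻¹}).eventually_cofinite_notMem] with z hz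
  simp only [Set.mem_insert_iff, Set.mem_singleton_iff, not_or] at hz
  exact head?_toWord_mul_mk_singleton hz.1 fun h => hz.2 (eq_inv_of_mul_eq_one_left h)

theorem head?_toWord_mul_of_eq_some_iff {i j : α} (hij : i ≠ j) (z : FreeGroup α) :
    (z * of i).toWord.head? = some (j, true) ↔ z.toWord.head? = some (j, true) := by
  by_cases h1 : z = 1
  · simp [h1, hij]
  by_cases h2 : z * of i = 1
  · simp [eq_inv_of_mul_eq_one_left h2, toWord_inv, invRev]
  · rw [← head?_toWord_mul_mk_singleton h1 h2]; rfl

theorem head?_toWord_of_zpow_eq_some_iff (j : α) (k : ℤ) :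
    (of j ^ k).toWord.head? = some (j, true) ↔ 0 < k := by
  obtain k | k := k
  · rw [Int.ofNat_eq_natCast, zpow_natCast, toWord_of_pow]
    cases k <;> simp [List.replicate_succ]
  · simp [zpow_negSucc, toWord_inv, toWord_of_pow, invRev, List.replicate_succ']

end Cones

theorem NoCutVertex.exists_almostConstantOn [Finite α] [Nontrivial α] {u : FreeGroup α}
    (h : NoCutVertex u) {χ : FreeGroup α → Bool} (hχ : AlmostInvariant χ)
    (hu : ∀ z, χ (z * u) = χ z) : ∃ c, AlmostConstantOn χ Set.univ c := by
  classical
  obtain ⟨N, hN⟩ := hχ.exists_eq_on_cone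
  have key : ∀ d l, IsReduced l → N ≤ l.length + d → ∃ c, AlmostConstantOn χ (cone l) c := by
    intro d
    induction d with
    | zero => exact fun l _ hd => ⟨χ (mk l), .of_forall (hN l hd)⟩
    | succ d ih =>
      intro l hl hd
      have hext : ∀ t, ∃ c, IsReduced (l ++ [t]) → AlmostConstantOn χ (cone (l ++ [t])) c := by
        intro t
        by_cases ht : IsReduced (l ++ [t])
        · exact (ih _ ht (by rw [List.length_append, List.length_singleton]; omega)).imp
            fun _ hc _ => hc
        · exact ⟨true, fun h => absurd h ht⟩
      choose f hf using hext
      have hconst : ∀ s t, IsReduced (l ++ [s]) → IsReduced (l ++ [t]) → f s = f t := by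
        intro s t hs ht
        obtain ⟨r, hsr, htr, hr⟩ := exists_forbidden_letter hl hs ht
        refine h r f (fun a b ha hb hturn => ?_) s t hsr htr
        refine hturn.eq_of_almostConstantOn hχ hu (hr b hb) ?_ ?_ (hf b (hr b hb)) <;>
          rw [bar_bar]
        exacts [hr a ha, hf a (hr a ha)]
      by_cases hex : ∃ s, IsReduced (l ++ [s])
      · obtain ⟨s, hs⟩ := hex
        exact ⟨f s, almostConstantOn_cone_of_extensions fun t ht => hconst s t hs ht ▸ hf t ht⟩
      · exact ⟨true, almostConstantOn_cone_of_extensions fun t ht => absurd ⟨t, ht⟩ hex⟩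
  obtain ⟨c, hc⟩ := key N [] .nil (by simp)
  exact ⟨c, by simpa [cone] using hc⟩

theorem NoCutVertex.basis_ne [Finite α] {u : FreeGroup α} (h : NoCutVertex u)
    (b : FreeGroupBasis α (FreeGroup α)) {i j : α} (hij : i ≠ j) : b i ≠ u := by
  classical
  rintro rfl
  have : Nontrivial α := ⟨i, j, hij⟩
  set χ : FreeGroup α → Bool := fun z => (b.repr z).toWord.head? = some (j, true) with hχ
  have hinv : AlmostInvariant χ := fun w => by
    filter_upwards [b.repr.injective.tendsto_cofinite.eventually
      (almostInvariant_head?_toWord (b.repr w))] with z hz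
    simp only [hχ, map_mul]
    rw [hz]
  obtain ⟨c, hc⟩ := h.exists_almostConstantOn hinv fun z => by
    simp only [hχ, map_mul, b.repr_apply_coe, head?_toWord_mul_of_eq_some_iff hij]
  have hzpow : ∀ k : ℤ, χ (b j ^ k) = decide (0 < k) := fun k => by
    simp only [hχ, map_zpow, b.repr_apply_coe, head?_toWord_of_zpow_eq_some_iff]
  have hbj : b j ≠ 1 := fun h => of_ne_one j (by rw [← b.repr_apply_coe, h, map_one])
  obtain ⟨k, hk, hpos, hneg⟩ := exists_ne_zero_of_eventually_cofinite
    ((tendsto_mul_zpow_cofinite 1 hbj).eventually hc)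
  simp only [one_mul, Set.mem_univ, true_imp_iff, hzpow] at hpos hneg
  have : decide (0 < (k : ℤ)) = decide (0 < (-k : ℤ)) := hpos.trans hneg.symm
  simp only [decide_eq_decide] at this
  omega

end Whitehead

section Bases

/-- `g` and `h` form a basis of `F₂`. -/
def IsBasisPair (g h : F₂) : Prop := ∃ b : FreeGroupBasis (Fin 2) F₂, b 0 = g ∧ b 1 = h

theorem isBasisPair_x_y : IsBasisPair x y := ⟨FreeGroupBasis.ofFreeGroup _, rfl, rfl⟩

namespace IsBasisPair

variable {g h : F₂}

theorem lift_mulEquiv (hb : IsBasisPair g h) (e : F₂ ≃* F₂) :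
    IsBasisPair (lift ![g, h] (e x)) (lift ![g, h] (e y)) := by
  obtain ⟨b, rfl, rfl⟩ := hb
  have hrepr : (b.repr.symm : F₂ →* F₂) = lift ![b 0, b 1] := by
    ext i
    fin_cases i <;> simp <;> rfl
  rw [← hrepr]
  exact ⟨⟨b.repr.trans e.symm⟩, rfl, rfl⟩

theorem swap (hb : IsBasisPair g h) : IsBasisPair h g := by
  have hinv : (lift ![y, x] : F₂ →* F₂).comp (lift ![y, x]) = MonoidHom.id _ := by
    ext i
    fin_cases i <;> simp [x, y]
  simpa [x, y] using hb.lift_mulEquiv (MonoidHom.toMulEquiv _ _ hinv hinv)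

theorem inv_left (hb : IsBasisPair g h) : IsBasisPair g⁻¹ h := by
  have hinv : (lift ![x⁻¹, y] : F₂ →* F₂).comp (lift ![x⁻¹, y]) = MonoidHom.id _ := by
    ext i
    fin_cases i <;> simp [x, y]
  simpa [x, y] using hb.lift_mulEquiv (MonoidHom.toMulEquiv _ _ hinv hinv)

theorem inv_right (hb : IsBasisPair g h) : IsBasisPair g h⁻¹ := hb.swap.inv_left.swap

theorem zpow_mul_right (hb : IsBasisPair g h) (k : ℤ) : IsBasisPair g (g ^ k * h) := by
  have hinv : ∀ k : ℤ, (lift ![x, x ^ k * y] : F₂ →* F₂).comp (lift ![x, x ^ (-k) * y]) =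
      MonoidHom.id _ := by
    intro k
    ext i
    fin_cases i <;> simp [x, y]
  have hinv' := hinv (-k)
  rw [neg_neg] at hinv'
  simpa [x, y] using hb.lift_mulEquiv (MonoidHom.toMulEquiv _ _ hinv' (hinv k))

theorem mul_zpow_right (hb : IsBasisPair g h) (k : ℤ) : IsBasisPair g (h * g ^ k) := by
  simpa using (hb.inv_right.zpow_mul_right (-k)).inv_right

theorem exists_mulEquiv (hb : IsBasisPair g h) : ∃ e : F₂ ≃* F₂, e x = g ∧ e y = h := by
  obtain ⟨b, rfl, rfl⟩ := hb
  exact ⟨b.repr.symm, rfl, rfl⟩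

theorem isPrimitive_left (hb : IsBasisPair g h) : IsPrimitive g := ⟨h, hb⟩

end IsBasisPair

theorem NoCutVertex.not_isPrimitive {u : F₂} (h : NoCutVertex u) : ¬ IsPrimitive u := by
  rintro ⟨-, b, hb, -⟩
  exact h.basis_ne b zero_ne_one hb

theorem IsPrimitive.map {u : F₂} (hu : IsPrimitive u) (e : F₂ ≃* F₂) : IsPrimitive (e u) := by
  obtain ⟨v, b, rfl, rfl⟩ := hu
  exact ⟨_, b.map e, rfl, rfl⟩

theorem IsPrimitive.inv {u : F₂} : IsPrimitive u → IsPrimitive u⁻¹ :=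
  fun ⟨_, hv⟩ => IsBasisPair.isPrimitive_left (IsBasisPair.inv_left hv)

theorem IsPower.map {u : F₂} (hu : IsPower u) (e : F₂ ≃* F₂) : IsPower (e u) := by
  obtain ⟨w, k, hw, hk, rfl⟩ := hu
  exact ⟨e w, k, (map_ne_one_iff e e.injective).2 hw, hk, map_pow e w k⟩

theorem IsPower.inv {u : F₂} (hu : IsPower u) : IsPower u⁻¹ := by
  obtain ⟨w, k, hw, hk, rfl⟩ := hu
  exact ⟨w⁻¹, k, inv_ne_one.2 hw, hk, (inv_pow w k).symm⟩

theorem IsPrimitive.not_isPower {u : F₂} (hu : IsPrimitive u) : ¬ IsPower u := by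
  obtain ⟨v, b, rfl, -⟩ := hu
  rintro ⟨w, k, -, hk, h⟩
  let f : F₂ →* Multiplicative ℤ :=
    (lift ![Multiplicative.ofAdd 1, 1]).comp (b.repr : F₂ →* F₂)
  have hf : f (b 0) = Multiplicative.ofAdd 1 := by simp [f]
  rw [h, map_pow] at hf
  have hdvd : (k : ℤ) * (f w).toAdd = 1 := by simpa using congrArg Multiplicative.toAdd hf
  have := Int.eq_one_or_neg_one_of_mul_eq_one hdvd
  omega

/-- `u` is conjugate to `v` or to the inverse of `v`. -/
def SameClass (u v : F₂) : Prop := IsConj u v ∨ IsConj u v⁻¹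

theorem SameClass.iff_of_forall {P : F₂ → Prop} (hmap : ∀ (e : F₂ ≃* F₂) u, P u → P (e u))
    (hinv : ∀ u, P u → P u⁻¹) {u v : F₂} (h : SameClass u v) : P u ↔ P v := by
  have hconj : ∀ {u v}, IsConj u v → P u → P v := by
    intro u v huv hu
    obtain ⟨c, rfl⟩ := isConj_iff.1 huv
    exact hmap (MulAut.conj c) u hu
  have hinv' : P v⁻¹ ↔ P v := ⟨fun h => inv_inv v ▸ hinv _ h, hinv v⟩
  obtain h | h := h
  · exact ⟨hconj h, hconj h.symm⟩
  · rw [← hinv']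
    exact ⟨hconj h, hconj h.symm⟩

theorem SameClass.isPrimitive_iff {u v : F₂} (h : SameClass u v) :
    IsPrimitive u ↔ IsPrimitive v :=
  h.iff_of_forall (fun e _ hu => hu.map e) fun _ hu => hu.inv

theorem SameClass.isPower_iff {u v : F₂} (h : SameClass u v) : IsPower u ↔ IsPower v :=
  h.iff_of_forall (fun e _ hu => hu.map e) fun _ hu => hu.inv

end Bases

section Words

/-- The product `g ^ a₁ * h ^ b₁ * g ^ a₂ * h ^ b₂ * ⋯` with exponents
`L = [(a₁, b₁), (a₂, b₂), …]`. -/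
def word {G : Type*} [Group G] (g h : G) (L : List (ℤ × ℤ)) : G :=
  (L.map fun e => g ^ e.1 * h ^ e.2).prod

variable {G : Type*} [Group G] (g h : G)

@[simp] theorem word_nil : word g h [] = 1 := rfl

@[simp] theorem word_cons (e : ℤ × ℤ) (L : List (ℤ × ℤ)) :
    word g h (e :: L) = g ^ e.1 * h ^ e.2 * word g h L := by simp [word]

theorem word_append (L M : List (ℤ × ℤ)) : word g h (L ++ M) = word g h L * word g h M := by
  simp [word]

theorem word_flatten_replicate (m : ℕ) (L : List (ℤ × ℤ)) :
    word g h (List.replicate m L).flatten = word g h L ^ m := by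
  induction m with
  | zero => simp
  | succ m ih => rw [List.replicate_succ, List.flatten_cons, word_append, ih, pow_succ']

theorem map_word {H : Type*} [Group H] (f : G →* H) (L : List (ℤ × ℤ)) :
    f (word g h L) = word (f g) (f h) L := by
  simp [word, map_list_prod, Function.comp_def]

theorem isConj_word_of_isRotated {L M : List (ℤ × ℤ)} (hr : L ~r M) :
    IsConj (word g h L) (word g h M) := by
  obtain ⟨n, rfl⟩ := hr
  rw [List.rotate_eq_drop_append_take_mod, word_append, isConj_comm]
  conv_rhs => rw [← List.take_append_drop (n % L.length) L, word_append]
  exact isConj_iff.2 ⟨word g h (L.take (n % L.length)), by group⟩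

theorem word_eq_word_zpow_mul {L : List (ℤ × ℤ)} (hL : ∀ e ∈ L, e.2 = 1) (k : ℤ) :
    word g h L = word g (g ^ k * h) (L.map fun e => (e.1 - k, 1)) := by
  rw [word, word, List.map_map]
  refine congrArg List.prod (List.map_congr_left fun e he => ?_)
  simp only [Function.comp_apply, hL e he, zpow_one]
  rw [← mul_assoc, ← zpow_add, sub_add_cancel]

theorem IsBasisPair.exists_map_word_eq {g h : F₂} (hb : IsBasisPair g h) :
    ∃ e : F₂ ≃* F₂, ∀ L, e (word g h L) = word x y L := by
  obtain ⟨e, rfl, rfl⟩ := hb.exists_mulEquiv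
  refine ⟨e.symm, fun L => ?_⟩
  rw [← MulEquiv.coe_toMonoidHom e, ← map_word]
  exact e.symm_apply_apply _

theorem IsBasisPair.isPrimitive_word {g h : F₂} (hb : IsBasisPair g h) {L : List (ℤ × ℤ)}
    (hL : IsPrimitive (word g h L)) : IsPrimitive (word x y L) := by
  obtain ⟨e, he⟩ := hb.exists_map_word_eq
  exact he L ▸ hL.map e

theorem IsBasisPair.isPower_word {g h : F₂} (hb : IsBasisPair g h) {L : List (ℤ × ℤ)}
    (hL : IsPower (word g h L)) : IsPower (word x y L) := by
  obtain ⟨e, he⟩ := hb.exists_map_word_eq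
  exact he L ▸ hL.map e

end Words

section Expansion

/-- The letter whose repetition is a power of the generator `i` with exponent `a ≠ 0`. -/
def letter (i : Fin 2) (a : ℤ) : Letter (Fin 2) := (i, decide (0 < a))

/-- The reduced word of the power of the generator `i` with exponent `a`. -/
def syllable (i : Fin 2) (a : ℤ) : List (Letter (Fin 2)) := List.replicate a.natAbs (letter i a)

/-- The letters of `word x y L`, without any cancellation. -/
def expand (L : List (ℤ × ℤ)) : List (Letter (Fin 2)) :=
  L.flatMap fun e => syllable 0 e.1 ++ syllable 1 e.2

/-- A condition on the exponents `L` under which no cancellation takes place in `word x y L`, even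
when it is read cyclically. -/
def NoCancel (L : List (ℤ × ℤ)) : Prop :=
  (∀ e ∈ L, e.1 ≠ 0 ∧ e.2 ≠ 0) ∨ ∀ e ∈ L, 0 < e.2

theorem NoCancel.mono {L M : List (ℤ × ℤ)} (h : NoCancel M) (hLM : L ⊆ M) : NoCancel L :=
  h.imp (fun h e he => h e (hLM he)) fun h e he => h e (hLM he)

theorem NoCancel.snd_ne_zero {L : List (ℤ × ℤ)} (h : NoCancel L) {e : ℤ × ℤ} (he : e ∈ L) :
    e.2 ≠ 0 :=
  h.elim (fun h => (h e he).2) fun h => (h e he).ne'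

@[simp] theorem expand_nil : expand [] = [] := rfl

@[simp] theorem expand_cons (e : ℤ × ℤ) (L : List (ℤ × ℤ)) :
    expand (e :: L) = syllable 0 e.1 ++ (syllable 1 e.2 ++ expand L) := by
  simp [expand]

@[simp] theorem expand_append (L M : List (ℤ × ℤ)) : expand (L ++ M) = expand L ++ expand M := by
  simp [expand]

theorem mk_syllable (i : Fin 2) (a : ℤ) : mk (syllable i a) = of i ^ a := by
  have hrep : mk (syllable i a) = mk [letter i a] ^ a.natAbs := by
    rw [syllable, pow_mk, List.flatten_replicate_singleton]
  rw [hrep]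
  rcases le_or_gt a 0 with ha | ha
  · have hinv : mk [letter i a] = (of i)⁻¹ := by simp [letter, ha.not_gt, of, inv_mk, invRev]
    rw [hinv, inv_pow, ← zpow_natCast, ← zpow_neg, Int.ofNat_natAbs_of_nonpos ha, neg_neg]
  · have hpos : mk [letter i a] = of i := by simp [letter, ha, of]
    rw [hpos, ← zpow_natCast, Int.natAbs_of_nonneg ha.le]

theorem mk_expand (L : List (ℤ × ℤ)) : mk (expand L) = word x y L := by
  induction L with
  | nil => rfl
  | cons e L ih =>
    rw [expand_cons, ← mul_mk, ← mul_mk, mk_syllable, mk_syllable, ih, word_cons, mul_assoc]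
    rfl

theorem head?_syllable {i : Fin 2} {a : ℤ} (ha : a ≠ 0) :
    (syllable i a).head? = some (letter i a) := by
  rw [syllable, List.head?_replicate, if_neg (Int.natAbs_ne_zero.2 ha)]

theorem getLast?_syllable {i : Fin 2} {a : ℤ} (ha : a ≠ 0) :
    (syllable i a).getLast? = some (letter i a) := by
  rw [syllable, List.getLast?_replicate, if_neg (Int.natAbs_ne_zero.2 ha)]

theorem eq_letter_of_mem_syllable {i : Fin 2} {a : ℤ} {s : Letter (Fin 2)}
    (hs : s ∈ syllable i a) : s = letter i a :=
  List.eq_of_mem_replicate hs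

theorem isReduced_syllable (i : Fin 2) (a : ℤ) : FreeGroup.IsReduced (syllable i a) := by
  rw [isReduced_iff_reduce_eq, syllable, reduce_replicate]

theorem getLast?_expand {L : List (ℤ × ℤ)} {e : ℤ × ℤ} (hL : L.getLast? = some e)
    (he : e.2 ≠ 0) : (expand L).getLast? = some (letter 1 e.2) := by
  obtain ⟨L, rfl⟩ := List.getLast?_eq_some_iff.1 hL
  simp [getLast?_syllable he]

theorem NoCancel.head?_expand {L : List (ℤ × ℤ)} (h : NoCancel L) {e : ℤ × ℤ} (he : e ∈ L)
    {s : Letter (Fin 2)} (hs : (expand L).head? = some s) (h1 : s.1 = 1) : s = letter 1 e.2 := by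
  obtain h | h := h
  · obtain _ | ⟨f, L⟩ := L
    · simp at he
    · rw [expand_cons, List.head?_append, head?_syllable (h f (by simp)).1] at hs
      obtain rfl : letter 0 f.1 = s := by simpa using hs
      simp [letter] at h1
  · obtain ⟨f, hf, hsf⟩ := List.mem_flatMap.1 (List.mem_of_mem_head? hs)
    rcases List.mem_append.1 hsf with hs0 | hs1
    · rw [eq_letter_of_mem_syllable hs0] at h1
      simp [letter] at h1
    · rw [eq_letter_of_mem_syllable hs1]
      simp [letter, h e he, h f hf]

theorem NoCancel.isReduced_expand {L : List (ℤ × ℤ)} (h : NoCancel L) :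
    FreeGroup.IsReduced (expand L) := by
  induction L with
  | nil => exact .nil
  | cons e L ih =>
    have he := h.snd_ne_zero List.mem_cons_self
    rw [expand_cons]
    refine List.isChain_append.2 ⟨isReduced_syllable _ _, List.isChain_append.2
      ⟨isReduced_syllable _ _, ih (h.mono (List.subset_cons_self _ _)), ?_⟩, ?_⟩
    · intro s hs t ht hst
      obtain rfl := eq_letter_of_mem_syllable (List.mem_of_mem_getLast? hs)
      obtain _ | ⟨f, L⟩ := L
      · simp at ht
      · have hf := (h.mono (List.subset_cons_self _ _)).head?_expand List.mem_cons_self ht hst.symm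
        obtain h | h := h
        · rw [expand_cons, List.head?_append, head?_syllable (h f (by simp)).1] at ht
          simp only [Option.some_or, Option.mem_def, Option.some.injEq] at ht
          subst ht
          simp [letter] at hst
        · simp [hf, letter, h e (by simp), h f (by simp)]
    · intro s hs t ht hst
      obtain rfl := eq_letter_of_mem_syllable (List.mem_of_mem_getLast? hs)
      rw [List.head?_append, head?_syllable he] at ht
      simp only [Option.some_or, Option.mem_def, Option.some.injEq] at ht
      subst ht
      simp [letter] at hst

end Expansion

section Turns

theorem isCyclicallyReduced_append_comm {α : Type*} {A B : List (Letter α)}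
    (h : IsCyclicallyReduced (A ++ B)) : IsCyclicallyReduced (B ++ A) := by
  rcases eq_or_ne A [] with rfl | hA
  · simpa using h
  rcases eq_or_ne B [] with rfl | hB
  · simpa using h
  obtain ⟨hred, hcyc⟩ := h
  obtain ⟨hA', hB', hAB⟩ := List.isChain_append.1 hred
  rw [List.getLast?_append_of_ne_nil _ hB, List.head?_append_of_ne_nil _ hA] at hcyc
  refine ⟨List.isChain_append.2 ⟨hB', hA', hcyc⟩, ?_⟩
  rwa [List.getLast?_append_of_ne_nil _ hA, List.head?_append_of_ne_nil _ hB]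

theorem hasTurn_of_append {α : Type*} {A B : List (Letter α)} (h : IsCyclicallyReduced (A ++ B))
    {s t : Letter α} (hs : A.getLast? = some s) (ht : B.head? = some t) :
    HasTurn (mk (A ++ B)) s t :=
  ⟨B ++ A, by simp [ht], by simp [hs], isCyclicallyReduced_append_comm h,
    isConj_iff.2 ⟨mk A, by rw [← mul_mk, ← mul_mk, mul_assoc, mul_inv_cancel_right]⟩⟩

namespace NoCancel

variable {L : List (ℤ × ℤ)}

theorem isCyclicallyReduced_expand (h : NoCancel L) : IsCyclicallyReduced (expand L) := by
  have hred := (h.mono (L := L ++ L) (by simp)).isReduced_expand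
  rw [expand_append] at hred
  exact ⟨h.isReduced_expand, (List.isChain_append.1 hred).2.2⟩

theorem hasTurn (h : NoCancel L) {A B : List (Letter (Fin 2))} (hL : expand L = A ++ B)
    {s t : Letter (Fin 2)} (hs : A.getLast? = some s) (ht : B.head? = some t) :
    HasTurn (word x y L) s t := by
  rw [← mk_expand, hL]
  exact hasTurn_of_append (hL ▸ h.isCyclicallyReduced_expand) hs ht

theorem hasTurn_xy (h : NoCancel L) {e : ℤ × ℤ} (he : e ∈ L) (h1 : e.1 ≠ 0) :
    HasTurn (word x y L) (letter 0 e.1) (letter 1 e.2) := by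
  have h2 := h.snd_ne_zero he
  obtain ⟨M, N, rfl⟩ := List.append_of_mem he
  refine h.hasTurn (A := expand M ++ syllable 0 e.1) (B := syllable 1 e.2 ++ expand N) ?_ ?_ ?_
  · simp
  · simp [getLast?_syllable h1]
  · simp [head?_syllable h2]

theorem hasTurn_of_expand_eq_syllable (h : NoCancel L) {A B : List (Letter (Fin 2))} {i : Fin 2}
    {a : ℤ} (hL : expand L = A ++ syllable i a ++ B) (ha : 2 ≤ |a|) :
    HasTurn (word x y L) (letter i a) (letter i a) := by
  rw [Int.abs_eq_natAbs] at ha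
  obtain ⟨k, hk⟩ := Nat.exists_eq_add_of_le' (Nat.ofNat_le_cast.1 ha)
  refine h.hasTurn (A := A ++ [letter i a])
    (B := List.replicate (k + 1) (letter i a) ++ B) ?_ (by simp) (by simp [List.replicate_succ])
  rw [hL, syllable, hk, List.replicate_succ]
  simp

theorem hasTurn_xx (h : NoCancel L) {e : ℤ × ℤ} (he : e ∈ L) (h1 : 2 ≤ |e.1|) :
    HasTurn (word x y L) (letter 0 e.1) (letter 0 e.1) := by
  obtain ⟨M, N, rfl⟩ := List.append_of_mem he
  exact h.hasTurn_of_expand_eq_syllable (A := expand M) (B := syllable 1 e.2 ++ expand N)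
    (by simp) h1

theorem hasTurn_yy (h : NoCancel L) {e : ℤ × ℤ} (he : e ∈ L) (h2 : 2 ≤ |e.2|) :
    HasTurn (word x y L) (letter 1 e.2) (letter 1 e.2) := by
  obtain ⟨M, N, rfl⟩ := List.append_of_mem he
  exact h.hasTurn_of_expand_eq_syllable (A := expand M ++ syllable 0 e.1) (B := expand N)
    (by simp) h2

theorem hasTurn_yx (h : NoCancel L) {e f : ℤ × ℤ} {M : List (ℤ × ℤ)} (hr : L ~r f :: M)
    (he : (f :: M).getLast? = some e) (hf : f.1 ≠ 0) :
    HasTurn (word x y L) (letter 1 e.2) (letter 0 f.1) := by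
  have hM : NoCancel (f :: M) := h.mono fun _ hg => hr.mem_iff.2 hg
  refine ⟨expand (f :: M), ?_, ?_, hM.isCyclicallyReduced_expand, ?_⟩
  · simp [head?_syllable hf]
  · exact getLast?_expand he (hM.snd_ne_zero (List.mem_of_mem_getLast? he))
  · rw [mk_expand]
    exact isConj_word_of_isRotated x y hr.symm

theorem exists_hasTurn_yx (h : NoCancel L) {f : ℤ × ℤ} (hf : f ∈ L) (h1 : f.1 ≠ 0) :
    ∃ e ∈ L, HasTurn (word x y L) (letter 1 e.2) (letter 0 f.1) := by
  obtain ⟨A, B, rfl⟩ := List.append_of_mem hf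
  have hr : A ++ f :: B ~r f :: (B ++ A) := List.isRotated_append
  have he := List.getLast?_eq_some_getLast (List.cons_ne_nil f (B ++ A))
  exact ⟨_, hr.mem_iff.2 (List.mem_of_mem_getLast? he), h.hasTurn_yx hr he h1⟩

end NoCancel

theorem exists_isRotated_transition {ι : Type*} {φ : ι → Bool} {L : List ι}
    (h : ∀ a, ∃ e ∈ L, φ e = a) (a : Bool) :
    ∃ e f M, L ~r f :: M ∧ (f :: M).getLast? = some e ∧ φ e = !a ∧ φ f = a := by
  obtain ⟨f, M, hr, hf⟩ : ∃ f M, L ~r f :: M ∧ φ f = !a := by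
    obtain ⟨f, hf, hφ⟩ := h (!a)
    obtain ⟨A, B, rfl⟩ := List.append_of_mem hf
    exact ⟨f, B ++ A, List.isRotated_append, hφ⟩
  obtain ⟨g, hg⟩ : ∃ g, (f :: M).find? (φ · = a) = some g := by
    obtain ⟨g, hg, hφ⟩ := h a
    exact Option.isSome_iff_exists.1 (List.find?_isSome.2 ⟨g, hr.mem_iff.1 hg, by simpa using hφ⟩)
  obtain ⟨hga, A, B, hAB, hA⟩ := List.find?_eq_some_iff_append.1 hg
  obtain rfl | ⟨A, e, rfl⟩ := List.eq_nil_or_concat' A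
  · obtain ⟨rfl, -⟩ := List.cons.inj hAB
    simp [hf] at hga
  · refine ⟨e, g, B ++ (A ++ [e]), hr.trans (hAB ▸ List.isRotated_append), ?_, ?_, ?_⟩
    · rw [← List.cons_append, ← List.append_assoc, List.getLast?_concat]
    · simpa [Bool.eq_not] using hA e (by simp)
    · simpa using hga

end Turns

section WhiteheadGraphs

theorem noCutVertex_of_cycle {α : Type*} {u : FreeGroup α} {a b c d : Letter α} (hac : a ≠ c)
    (hbd : b ≠ d) (hcover : ∀ s, s = a ∨ s = b ∨ s = c ∨ s = d)
    (hab : HasTurn u (bar a) b ∨ HasTurn u (bar b) a)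
    (hbc : HasTurn u (bar b) c ∨ HasTurn u (bar c) b)
    (hcd : HasTurn u (bar c) d ∨ HasTurn u (bar d) c)
    (hda : HasTurn u (bar d) a ∨ HasTurn u (bar a) d) : NoCutVertex u := by
  intro r f hf
  have hedge : ∀ s t, HasTurn u (bar s) t ∨ HasTurn u (bar t) s → s ≠ r → t ≠ r → f s = f t :=
    fun s t h hs ht => h.elim (hf s t hs ht) fun h => (hf t s ht hs h).symm
  replace hab := hedge a b hab
  replace hbc := hedge b c hbc
  replace hcd := hedge c d hcd
  replace hda := hedge d a hda
  have hac' : a ≠ r ∨ c ≠ r := or_iff_not_imp_left.2 fun h h' => h (h' ▸ hac)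
  have hbd' : b ≠ r ∨ d ≠ r := or_iff_not_imp_left.2 fun h h' => h (h' ▸ hbd)
  clear hf hedge
  intro s t hs ht
  rcases hcover s with rfl | rfl | rfl | rfl <;> rcases hcover t with rfl | rfl | rfl | rfl <;>
    rcases hac' with _ | _ <;> rcases hbd' with _ | _ <;> simp_all

theorem noCutVertex_of_alternating {u : F₂}
    (h : ∀ a b, HasTurn u (bar (0, a)) (1, b) ∨ HasTurn u (bar (1, b)) (0, a)) :
    NoCutVertex u :=
  noCutVertex_of_cycle (a := (0, true)) (b := (1, true)) (c := (0, false)) (d := (1, false))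
    (by decide) (by decide) (by decide) (h _ _) (h _ _).symm (h _ _) (h _ _).symm

theorem noCutVertex_of_squares {u : F₂} {a b : Bool} (hxx : HasTurn u (0, a) (0, a))
    (hyy : HasTurn u (1, b) (1, b)) (hxy : HasTurn u (0, a) (1, b))
    (hyx : HasTurn u (1, b) (0, a)) : NoCutVertex u :=
  noCutVertex_of_cycle (a := (0, a)) (b := bar (0, a)) (c := (1, b)) (d := bar (1, b))
    (by simp) (by simp [bar]) (by cases a <;> cases b <;> decide) (.inr (by rwa [bar_bar]))
    (.inl (by rwa [bar_bar])) (.inr (by rwa [bar_bar])) (.inl (by rwa [bar_bar]))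

namespace NoCancel

variable {L : List (ℤ × ℤ)}

theorem noCutVertex_of_mixed_fst (h : NoCancel L) (h0 : ∀ e ∈ L, e.1 ≠ 0)
    (hmixed : ∀ a, ∃ e ∈ L, decide (0 < e.1) = a) : NoCutVertex (word x y L) := by
  refine noCutVertex_of_alternating fun a b => ?_
  obtain ⟨e, f, M, hr, hlast, he, hf⟩ := exists_isRotated_transition hmixed a
  have heL : e ∈ L := hr.mem_iff.2 (List.mem_of_mem_getLast? hlast)
  have hfL : f ∈ L := hr.mem_iff.2 List.mem_cons_self
  have hxy := h.hasTurn_xy heL (h0 e heL)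
  have hyx := h.hasTurn_yx hr hlast (h0 f hfL)
  rw [letter, letter, he] at hxy
  rw [letter, letter, hf] at hyx
  by_cases hb : decide (0 < e.2) = b
  · exact .inl (hb ▸ hxy)
  · rw [Bool.eq_not_of_ne hb] at hyx
    exact .inr hyx

theorem noCutVertex_of_mixed_snd (h : NoCancel L) (h0 : ∀ e ∈ L, e.1 ≠ 0)
    (hmixed : ∀ a, ∃ e ∈ L, decide (0 < e.2) = a) : NoCutVertex (word x y L) := by
  refine noCutVertex_of_alternating fun a b => ?_
  obtain ⟨e, f, M, hr, hlast, he, hf⟩ := exists_isRotated_transition hmixed b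
  have hfL : f ∈ L := hr.mem_iff.2 List.mem_cons_self
  have hxy := h.hasTurn_xy hfL (h0 f hfL)
  have hyx := h.hasTurn_yx hr hlast (h0 f hfL)
  rw [letter, letter, hf] at hxy
  rw [letter, letter, he] at hyx
  by_cases ha : decide (0 < f.1) = a
  · exact .inr (ha ▸ hyx)
  · rw [Bool.eq_not_of_ne ha] at hxy
    exact .inl hxy

theorem noCutVertex_of_squares (h : NoCancel L) (h0 : ∀ e ∈ L, e.1 ≠ 0) {a b : Bool}
    (ha : ∀ e ∈ L, decide (0 < e.1) = a) (hb : ∀ e ∈ L, decide (0 < e.2) = b)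
    (h1 : ∃ e ∈ L, 2 ≤ |e.1|) (h2 : ∃ e ∈ L, 2 ≤ |e.2|) : NoCutVertex (word x y L) := by
  obtain ⟨e, he, he1⟩ := h1
  obtain ⟨f, hf, hf2⟩ := h2
  have hxx := h.hasTurn_xx he he1
  have hyy := h.hasTurn_yy hf hf2
  have hxy := h.hasTurn_xy he (h0 e he)
  obtain ⟨g, hg, hyx⟩ := h.exists_hasTurn_yx he (h0 e he)
  simp only [letter, ha e he, hb e he, hb f hf, hb g hg] at hxx hyy hxy hyx
  exact KleinWords.noCutVertex_of_squares hxx hyy hxy hyx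

end NoCancel

theorem noCutVertex_of_pos_snd {L : List (ℤ × ℤ)} (hL : ∀ e ∈ L, 0 < e.2)
    (hpos : ∃ e ∈ L, 0 < e.1) (hneg : ∃ e ∈ L, e.1 < 0) : NoCutVertex (word x y L) := by
  have h : NoCancel L := .inr hL
  have hsign : ∀ a, ∃ e ∈ L, e.1 ≠ 0 ∧ decide (0 < e.1) = a := by
    rintro (_ | _)
    · exact hneg.imp fun e he => ⟨he.1, he.2.ne, by simpa using he.2.le⟩
    · exact hpos.imp fun e he => ⟨he.1, he.2.ne', by simpa using he.2⟩
  refine noCutVertex_of_alternating ?_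
  rintro a (_ | _)
  · obtain ⟨e, he, he0, hea⟩ := hsign a
    obtain ⟨f, hf, hyx⟩ := h.exists_hasTurn_yx he he0
    rw [letter, letter, hea, decide_eq_true (hL f hf)] at hyx
    exact .inr hyx
  · obtain ⟨e, he, he0, hea⟩ := hsign (!a)
    have hxy := h.hasTurn_xy he he0
    rw [letter, letter, hea, decide_eq_true (hL e he)] at hxy
    exact .inl hxy

end WhiteheadGraphs

section PrimitiveCriteria

variable {g h : F₂} {L : List (ℤ × ℤ)}

theorem IsBasisPair.not_isPrimitive_of_noCutVertex (hb : IsBasisPair g h)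
    (hL : NoCutVertex (word x y L)) : ¬ IsPrimitive (word g h L) :=
  fun hu => hL.not_isPrimitive (hb.isPrimitive_word hu)

theorem exists_decide_pos_eq {ι : Type*} {f : ι → ℤ} {S : List ι} (hpos : ∃ e ∈ S, 0 < f e)
    (hneg : ∃ e ∈ S, f e < 0) (a : Bool) : ∃ e ∈ S, decide (0 < f e) = a := by
  cases a
  · exact hneg.imp fun e he => ⟨he.1, by simpa using he.2.le⟩
  · simpa using hpos

theorem IsBasisPair.not_isPrimitive_of_mixed_fst (hb : IsBasisPair g h)
    (h0 : ∀ e ∈ L, e.1 ≠ 0 ∧ e.2 ≠ 0) (hpos : ∃ e ∈ L, 0 < e.1) (hneg : ∃ e ∈ L, e.1 < 0) :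
    ¬ IsPrimitive (word g h L) :=
  hb.not_isPrimitive_of_noCutVertex <| NoCancel.noCutVertex_of_mixed_fst (.inl h0)
    (fun e he => (h0 e he).1) (exists_decide_pos_eq hpos hneg)

theorem IsBasisPair.not_isPrimitive_of_mixed_snd (hb : IsBasisPair g h)
    (h0 : ∀ e ∈ L, e.1 ≠ 0 ∧ e.2 ≠ 0) (hpos : ∃ e ∈ L, 0 < e.2) (hneg : ∃ e ∈ L, e.2 < 0) :
    ¬ IsPrimitive (word g h L) :=
  hb.not_isPrimitive_of_noCutVertex <| NoCancel.noCutVertex_of_mixed_snd (.inl h0)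
    (fun e he => (h0 e he).1) (exists_decide_pos_eq hpos hneg)

theorem IsBasisPair.not_isPrimitive_of_squares (hb : IsBasisPair g h)
    (h0 : ∀ e ∈ L, e.1 ≠ 0 ∧ e.2 ≠ 0) (h1 : ∃ e ∈ L, 2 ≤ |e.1|) (h2 : ∃ e ∈ L, 2 ≤ |e.2|) :
    ¬ IsPrimitive (word g h L) := by
  refine hb.not_isPrimitive_of_noCutVertex ?_
  have hnc : NoCancel L := .inl h0
  have hfst : ∀ e ∈ L, e.1 ≠ 0 := fun e he => (h0 e he).1
  by_cases hmixed₁ : ∀ a, ∃ e ∈ L, decide (0 < e.1) = a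
  · exact hnc.noCutVertex_of_mixed_fst hfst hmixed₁
  by_cases hmixed₂ : ∀ b, ∃ e ∈ L, decide (0 < e.2) = b
  · exact hnc.noCutVertex_of_mixed_snd hfst hmixed₂
  push Not at hmixed₁ hmixed₂
  obtain ⟨a, ha⟩ := hmixed₁
  obtain ⟨b, hb⟩ := hmixed₂
  exact hnc.noCutVertex_of_squares hfst (fun e he => Bool.eq_not_of_ne (ha e he))
    (fun e he => Bool.eq_not_of_ne (hb e he)) h1 h2

theorem IsBasisPair.not_isPrimitive_of_spread (hb : IsBasisPair g h) (hL : ∀ e ∈ L, e.2 = 1)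
    (hspread : ∃ e ∈ L, ∃ f ∈ L, e.1 + 2 ≤ f.1) : ¬ IsPrimitive (word g h L) := by
  obtain ⟨e, he, f, hf, hef⟩ := hspread
  -- The substitution `h ↦ g ^ (-k) * h` lowers every exponent of `g` by `k`; with `k` strictly
  -- between `e.1` and `f.1` both signs occur.
  rw [word_eq_word_zpow_mul g h hL (e.1 + 1)]
  refine (hb.zpow_mul_right _).not_isPrimitive_of_noCutVertex (noCutVertex_of_pos_snd ?_ ?_ ?_)
  · exact List.forall_mem_map.2 fun _ _ => one_pos
  · exact ⟨_, List.mem_map_of_mem hf, by dsimp only; omega⟩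
  · exact ⟨_, List.mem_map_of_mem he, by dsimp only; omega⟩

end PrimitiveCriteria

section PowerCriterion

theorem splitBy_flatten_replicate {ι : Type*} {r : ι → ι → Bool} {E : List ι}
    (hE : ∀ s ∈ E.getLast?, ∀ t ∈ E.head?, r s t = false) (k : ℕ) :
    (List.replicate k E).flatten.splitBy r = (List.replicate k (E.splitBy r)).flatten := by
  induction k with
  | zero => rfl
  | succ k ih =>
    rw [List.replicate_succ, List.flatten_cons, List.replicate_succ, List.flatten_cons, ← ih,
      List.splitBy_append]
    intro s hs t ht
    refine hE s hs t ?_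
    obtain _ | k := k
    · simp at ht
    · obtain _ | ⟨a, E⟩ := E
      · simp at hs
      · simpa [List.replicate_succ] using ht

theorem exists_eq_flatten_replicate_of_mk_eq_pow {α : Type*} {D : List (Letter α)}
    (hD : IsCyclicallyReduced D) {w : FreeGroup α} {k : ℕ} (hk : k ≠ 0) (h : mk D = w ^ k) :
    ∃ E, D = (List.replicate k E).flatten := by
  classical
  have hw : FreeGroup.IsReduced w.toWord := isReduced_toWord
  refine ⟨reduceCyclically w.toWord, ?_⟩
  have hconj : D = reduceCyclically.conjugator w.toWord ++
      (List.replicate k (reduceCyclically w.toWord)).flatten ++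
      invRev (reduceCyclically.conjugator w.toWord) := by
    rw [← hD.isReduced.reduce_eq, ← toWord_mk, h, toWord_pow,
      reduceCyclically.reduce_flatten_replicate hw, if_neg hk]
  rcases hC : reduceCyclically.conjugator w.toWord with _ | ⟨a, C⟩
  · simpa [hC] using hconj
  · rw [hC] at hconj
    have hhead : D.head? = some a := by simp [hconj]
    have hlast : D.getLast? = some (bar a) := by
      rw [hconj, List.getLast?_append]
      simp [invRev, bar]
    simpa [bar] using hD.2 _ hlast _ hhead rfl

/-- The exponent sum of the generator `i` in the word `D`. -/
def exponentSum (i : Fin 2) (D : List (Letter (Fin 2))) : ℤ :=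
  D.count (i, true) - D.count (i, false)

theorem exponentSum_append (i : Fin 2) (D E : List (Letter (Fin 2))) :
    exponentSum i (D ++ E) = exponentSum i D + exponentSum i E := by
  simp only [exponentSum, List.count_append]
  push_cast
  ring

theorem exponentSum_syllable (i j : Fin 2) (a : ℤ) :
    exponentSum i (syllable j a) = if i = j then a else 0 := by
  have hcount : ∀ b : Bool, (syllable j a).count (i, b) =
      if letter j a = (i, b) then a.natAbs else 0 := by
    simp [syllable, List.count_replicate]
  rw [exponentSum, hcount, hcount]
  obtain rfl | hij := eq_or_ne i j
  · by_cases ha : 0 < a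
    · simp [letter, ha, abs_of_pos ha]
    · simp [letter, ha, abs_of_nonpos (not_lt.1 ha)]
  · simp [letter, hij, hij.symm]

/-- The relation along which `List.splitBy` cuts `expand L` into the pieces
`syllable 0 a ++ syllable 1 b`: a cut occurs where a letter `y ^ ±1` is followed by `x ^ ±1`. -/
def sameBlock (s t : Letter (Fin 2)) : Bool := !(s.1 = 1 ∧ t.1 = 0)

theorem isChain_sameBlock (e : ℤ × ℤ) :
    (syllable 0 e.1 ++ syllable 1 e.2).IsChain fun s t => sameBlock s t := by
  have hsyll : ∀ (i : Fin 2) (a : ℤ), (syllable i a).IsChain fun s t => sameBlock s t := by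
    intro i a
    refine List.isChain_replicate_of_rel _ ?_
    fin_cases i <;> simp [sameBlock, letter]
  refine List.isChain_append.2 ⟨hsyll 0 _, hsyll 1 _, fun s hs t _ => ?_⟩
  rw [eq_letter_of_mem_syllable (List.mem_of_mem_getLast? hs)]
  simp [sameBlock, letter]

theorem sameBlock_expand {L M : List (ℤ × ℤ)} (hL : ∀ e ∈ L, e.2 ≠ 0) (hM : ∀ e ∈ M, e.1 ≠ 0) :
    ∀ s ∈ (expand L).getLast?, ∀ t ∈ (expand M).head?, sameBlock s t = false := by
  intro s hs t ht
  obtain rfl | ⟨L, e, rfl⟩ := List.eq_nil_or_concat' L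
  · simp at hs
  obtain _ | ⟨f, M⟩ := M
  · simp at ht
  rw [getLast?_expand List.getLast?_concat (hL e (by simp))] at hs
  rw [expand_cons, List.head?_append, head?_syllable (hM f List.mem_cons_self)] at ht
  obtain rfl : letter 1 e.2 = s := by simpa using hs
  obtain rfl : letter 0 f.1 = t := by simpa using ht
  rfl

theorem splitBy_sameBlock_expand {L : List (ℤ × ℤ)} (h0 : ∀ e ∈ L, e.1 ≠ 0 ∧ e.2 ≠ 0) :
    (expand L).splitBy sameBlock = L.map fun e => syllable 0 e.1 ++ syllable 1 e.2 := by
  induction L with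
  | nil => rfl
  | cons e L ih =>
    obtain ⟨he, hL⟩ := List.forall_mem_cons.1 h0
    have hblock : expand [e] = syllable 0 e.1 ++ syllable 1 e.2 := by simp
    have hne : syllable 0 e.1 ++ syllable 1 e.2 ≠ [] := by simp [syllable, he.1]
    have hcut := sameBlock_expand (L := [e]) (by simpa using he.2) fun f hf => (hL f hf).1
    rw [← List.singleton_append, expand_append, List.splitBy_append hcut, hblock,
      List.splitBy_of_isChain hne (isChain_sameBlock e), ih hL, List.map_append, List.map_singleton]

theorem dvd_sum_of_word_eq_pow {L : List (ℤ × ℤ)} (h0 : ∀ e ∈ L, e.1 ≠ 0 ∧ e.2 ≠ 0) {w : F₂}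
    {k : ℕ} (hk : k ≠ 0) (h : word x y L = w ^ k) (f : ℤ × ℤ → ℤ) : (k : ℤ) ∣ (L.map f).sum := by
  have hcyc : IsCyclicallyReduced (expand L) := NoCancel.isCyclicallyReduced_expand (.inl h0)
  rw [← mk_expand] at h
  obtain ⟨E, hE⟩ := exists_eq_flatten_replicate_of_mk_eq_pow hcyc hk h
  let weight (D : List (Letter (Fin 2))) : ℤ := f (exponentSum 0 D, exponentSum 1 D)
  have hblocks : L.map f = ((expand L).splitBy sameBlock).map weight := by
    rw [splitBy_sameBlock_expand h0, List.map_map]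
    refine List.map_congr_left fun e _ => ?_
    simp [weight, exponentSum_append, exponentSum_syllable]
  have hcut : ∀ s ∈ E.getLast?, ∀ t ∈ E.head?, sameBlock s t = false := by
    intro s hs t ht
    obtain ⟨k, rfl⟩ := Nat.exists_eq_succ_of_ne_zero hk
    refine sameBlock_expand (fun e he => (h0 e he).2) (fun e he => (h0 e he).1) s ?_ t ?_
    · rw [hE, List.replicate_succ', List.flatten_append, List.getLast?_append]
      simp [Option.mem_def.1 hs]
    · rw [hE, List.replicate_succ, List.flatten_cons, List.head?_append]
      simp [Option.mem_def.1 ht]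
  rw [hblocks, hE, splitBy_flatten_replicate hcut, List.map_flatten, List.map_replicate,
    List.sum_flatten, List.map_replicate, List.sum_replicate, nsmul_eq_mul]
  exact dvd_mul_right _ _

theorem IsBasisPair.not_isPower_of_sum_eq_one {g h : F₂} (hb : IsBasisPair g h)
    {L : List (ℤ × ℤ)} (h0 : ∀ e ∈ L, e.1 ≠ 0 ∧ e.2 ≠ 0) (f : ℤ × ℤ → ℤ)
    (hf : (L.map f).sum = 1) : ¬ IsPower (word g h L) := by
  intro hu
  obtain ⟨w, k, -, hk, hw⟩ := hb.isPower_word hu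
  have hdvd := dvd_sum_of_word_eq_pow h0 (by omega) hw f
  rw [hf] at hdvd
  have := Int.eq_one_of_dvd_one (by positivity) hdvd
  omega

theorem IsBasisPair.not_isPower_of_snd_eq_one {g h : F₂} (hb : IsBasisPair g h)
    {L : List (ℤ × ℤ)} (hL : ∀ e ∈ L, e.2 = 1) (f : ℤ × ℤ → ℤ) (hf : (L.map f).sum = 1) :
    ¬ IsPower (word g h L) := by
  obtain ⟨K, hK⟩ := (L.toFinset.finite_toSet.image Prod.fst).bddBelow
  rw [word_eq_word_zpow_mul g h hL (K - 1)]
  refine (hb.zpow_mul_right (K - 1)).not_isPower_of_sum_eq_one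
    (List.forall_mem_map.2 fun e he => ⟨?_, one_ne_zero⟩) (fun e => f (e.1 + (K - 1), 1)) ?_
  · have := hK ⟨e, by simpa using he, rfl⟩
    dsimp only
    omega
  · rw [List.map_map]
    refine (congrArg List.sum (List.map_congr_left fun e he => ?_)).trans hf
    simp only [Function.comp_apply, sub_add_cancel]
    exact congrArg f (Prod.ext rfl (hL e he).symm)

end PowerCriterion

section Neither

/-- `u` is neither primitive nor a power. -/
def IsNeither (u : F₂) : Prop := ¬ IsPrimitive u ∧ ¬ IsPower u

variable {u g h : F₂} {L : List (ℤ × ℤ)}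

theorem SameClass.isNeither_iff {u v : F₂} (huv : SameClass u v) : IsNeither u ↔ IsNeither v :=
  and_congr huv.isPrimitive_iff.not huv.isPower_iff.not

theorem SameClass.isNeither_of_mixed_fst (hu : SameClass u (word g h L)) (hb : IsBasisPair g h)
    (h0 : ∀ e ∈ L, e.1 ≠ 0 ∧ e.2 ≠ 0) (hpos : ∃ e ∈ L, 0 < e.1) (hneg : ∃ e ∈ L, e.1 < 0)
    (f : ℤ × ℤ → ℤ) (hf : (L.map f).sum = 1) : IsNeither u :=
  hu.isNeither_iff.2
    ⟨hb.not_isPrimitive_of_mixed_fst h0 hpos hneg, hb.not_isPower_of_sum_eq_one h0 f hf⟩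

theorem SameClass.isNeither_of_mixed_snd (hu : SameClass u (word g h L)) (hb : IsBasisPair g h)
    (h0 : ∀ e ∈ L, e.1 ≠ 0 ∧ e.2 ≠ 0) (hpos : ∃ e ∈ L, 0 < e.2) (hneg : ∃ e ∈ L, e.2 < 0)
    (f : ℤ × ℤ → ℤ) (hf : (L.map f).sum = 1) : IsNeither u :=
  hu.isNeither_iff.2
    ⟨hb.not_isPrimitive_of_mixed_snd h0 hpos hneg, hb.not_isPower_of_sum_eq_one h0 f hf⟩

theorem SameClass.isNeither_of_squares (hu : SameClass u (word g h L)) (hb : IsBasisPair g h)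
    (h0 : ∀ e ∈ L, e.1 ≠ 0 ∧ e.2 ≠ 0) (h1 : ∃ e ∈ L, 2 ≤ |e.1|) (h2 : ∃ e ∈ L, 2 ≤ |e.2|)
    (f : ℤ × ℤ → ℤ) (hf : (L.map f).sum = 1) : IsNeither u :=
  hu.isNeither_iff.2
    ⟨hb.not_isPrimitive_of_squares h0 h1 h2, hb.not_isPower_of_sum_eq_one h0 f hf⟩

theorem SameClass.isNeither_of_spread (hu : SameClass u (word g h L)) (hb : IsBasisPair g h)
    (hL : ∀ e ∈ L, e.2 = 1) (hspread : ∃ e ∈ L, ∃ f ∈ L, e.1 + 2 ≤ f.1)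
    (f : ℤ × ℤ → ℤ) (hf : (L.map f).sum = 1) : IsNeither u :=
  hu.isNeither_iff.2
    ⟨hb.not_isPrimitive_of_spread hL hspread, hb.not_isPower_of_snd_eq_one hL f hf⟩

/-- The exponents of `word g h A * word g h M ^ m`. -/
def periodic (A M : List (ℤ × ℤ)) (m : ℕ) : List (ℤ × ℤ) := A ++ (List.replicate m M).flatten

variable {A M : List (ℤ × ℤ)} {m : ℕ}

@[simp] theorem mem_periodic {e : ℤ × ℤ} : e ∈ periodic A M m ↔ e ∈ A ∨ m ≠ 0 ∧ e ∈ M := by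
  simp [periodic]

theorem sum_map_periodic (f : ℤ × ℤ → ℤ) :
    ((periodic A M m).map f).sum = (A.map f).sum + m * (M.map f).sum := by
  simp [periodic, List.map_flatten, List.sum_flatten]

theorem word_periodic : word g h (periodic A M m) = word g h A * word g h M ^ m := by
  rw [periodic, word_append, word_flatten_replicate]

theorem sameClass_of_mul_eq {u v : F₂} (d : F₂) (h : d * v = u * d) : SameClass u v :=
  .inl (isConj_comm.1 (isConj_iff.2 ⟨d, mul_inv_eq_of_eq_mul h⟩))

theorem sameClass_of_mul_eq_inv {u v : F₂} (d : F₂) (h : d * v = u⁻¹ * d) : SameClass u v := by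
  refine .inr (isConj_comm.1 (isConj_iff.2 ⟨d, ?_⟩))
  rw [← inv_inv u, ← mul_inv_eq_of_eq_mul h]
  group

theorem mul_word_periodic {ℓ B : F₂} (k : ℤ) (d : F₂) (hA : d * word g h A = ℓ * B ^ k * d)
    (hM : d * word g h M = B * d) :
    d * word g h (periodic A M m) = ℓ * B ^ (m + k : ℤ) * d := by
  have hMm : d * word g h M ^ m = B ^ m * d := SemiconjBy.pow_right hM m
  rw [word_periodic, ← mul_assoc, hA, mul_assoc, hMm, add_comm, zpow_add, zpow_natCast]
  simp only [mul_assoc]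

theorem sameClass_periodic {ℓ B : F₂} {k : ℤ} (d : F₂) (hA : d * word g h A = ℓ * B ^ k * d)
    (hM : d * word g h M = B * d) :
    SameClass (ℓ * B ^ (m + k : ℤ)) (word g h (periodic A M m)) :=
  sameClass_of_mul_eq d (mul_word_periodic k d hA hM)

theorem sameClass_periodic_neg {ℓ B : F₂} {k : ℤ} (d : F₂)
    (hA : d * word g h A = ℓ⁻¹ * B ^ k * d) (hM : d * word g h M = B * d) :
    SameClass (ℓ * B ^ (-(m + k : ℤ))) (word g h (periodic A M m)) := by
  refine sameClass_of_mul_eq_inv (ℓ * d) ?_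
  rw [mul_assoc, mul_word_periodic k d hA hM]
  group

theorem isPrimitive_iff_and_isPower_iff {R S : Prop} (hR : R → IsPrimitive u)
    (hS : S → IsPower u) (hN : ¬ R → ¬ S → IsNeither u) :
    (IsPrimitive u ↔ R) ∧ (IsPower u ↔ S) := by
  refine ⟨⟨fun h => ?_, hR⟩, ⟨fun h => ?_, hS⟩⟩
  · by_contra hc
    exact (hN hc fun hs => h.not_isPower (hS hs)).1 h
  · by_contra hc
    exact (hN (fun hr => (hR hr).not_isPower h) hc).2 h

theorem IsBasisPair.isPrimitive_mul_zpow (hb : IsBasisPair g h) (k : ℤ) :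
    IsPrimitive (g * h ^ k) :=
  (hb.swap.mul_zpow_right k).swap.isPrimitive_left

theorem IsPrimitive.ne_one (hu : IsPrimitive u) : u ≠ 1 := by
  obtain ⟨-, b, rfl, -⟩ := hu
  intro h
  have hrepr := congrArg b.repr h
  rw [FreeGroupBasis.repr_apply_coe, _root_.map_one] at hrepr
  exact of_ne_one _ hrepr

theorem IsPrimitive.isPower_pow (hu : IsPrimitive u) {k : ℕ} (hk : 2 ≤ k) : IsPower (u ^ k) :=
  ⟨u, k, hu.ne_one, hk, rfl⟩

theorem IsBasisPair.isPower_right_pow (hb : IsBasisPair g h) {k : ℕ} (hk : 2 ≤ k) :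
    IsPower (h ^ k) :=
  hb.swap.isPrimitive_left.isPower_pow hk

theorem isPrimitive_x_zpow {p : ℤ} (hp : p = 1 ∨ p = -1) : IsPrimitive (x ^ p) := by
  obtain rfl | rfl := hp
  · simpa using isBasisPair_x_y.isPrimitive_left
  · simpa using isBasisPair_x_y.inv_left.isPrimitive_left

theorem isPower_x_zpow {p : ℤ} (hp : 2 ≤ |p|) : IsPower (x ^ p) := by
  obtain ⟨k, rfl | rfl⟩ := p.eq_nat_or_neg
  · rw [zpow_natCast]
    exact isBasisPair_x_y.isPrimitive_left.isPower_pow (by simpa using hp)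
  · rw [zpow_neg, zpow_natCast, ← inv_pow]
    exact isBasisPair_x_y.inv_left.isPrimitive_left.isPower_pow (by simpa using hp)

theorem eq_zero_or_succ_or_neg_succ (n : ℤ) :
    n = 0 ∨ (∃ m : ℕ, n = m + 1) ∨ ∃ m : ℕ, n = -(m + 1) := by
  rcases n with (_ | m) | m
  · exact .inl rfl
  · exact .inr (.inl ⟨m, rfl⟩)
  · exact .inr (.inr ⟨m, rfl⟩)

end Neither

section FirstFamily

variable (m : ℕ) {p q : ℤ}

theorem isBasisPair_inv_x_mul_y_y : IsBasisPair (x⁻¹ * y) y := by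
  simpa using (isBasisPair_x_y.swap.inv_right.mul_zpow_right 1).swap

theorem isBasisPair_x_mul_y_x : IsBasisPair (x * y) x := by
  simpa using (isBasisPair_x_y.zpow_mul_right 1).swap

theorem isNeither_c₀'_succ (hp : p ≠ 0) (hp' : p ≠ -1) (hq : q ≠ -1)
    (hmpq : ¬ (m = 0 ∧ p = -2 ∧ q = 0)) : IsNeither (c₀' (m + 1) p q) := by
  have hu : SameClass (c₀' (m + 1) p q) (word x y (periodic
      [(2 * p + 1, 1), (p, q + 1), (p, 1)] [(p + 1, 1), (p, q + 1), (p, 1)] m)) :=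
    sameClass_periodic 1 (by simp only [word_cons, word_nil]; group)
      (by simp only [word_cons, word_nil]; group)
  rcases lt_trichotomy q 0 with hq0 | rfl | hq0
  · exact hu.isNeither_of_mixed_snd isBasisPair_x_y (by grind [mem_periodic])
      ⟨(p, 1), by grind [mem_periodic]⟩ ⟨(p, q + 1), by grind [mem_periodic]⟩
      (fun e => if e.1 = 2 * p + 1 then 1 else 0) (by rw [sum_map_periodic]; grind)
  · refine hu.isNeither_of_spread isBasisPair_x_y (by grind [mem_periodic]) ?_
      (fun e => if e.1 = 2 * p + 1 then 1 else 0) (by rw [sum_map_periodic]; grind)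
    by_cases hp0 : 0 < p
    · exact ⟨(p, 1), by simp, (2 * p + 1, 1), by simp, by grind⟩
    by_cases hm : m = 0
    · exact ⟨(2 * p + 1, 1), by simp, (p, 1), by simp, by grind⟩
    · exact ⟨(2 * p + 1, 1), by simp, (p + 1, 1), by simp [hm], by grind⟩
  · exact hu.isNeither_of_squares isBasisPair_x_y (by grind [mem_periodic])
      ⟨(2 * p + 1, 1), by grind [mem_periodic]⟩ ⟨(p, q + 1), by grind [mem_periodic]⟩
      (fun e => if e.1 = 2 * p + 1 then 1 else 0) (by rw [sum_map_periodic]; grind)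

theorem isNeither_c₀'_succ_neg_one_right (hm : m ≠ 0) (hp : p ≠ 0) (hp' : p ≠ 1) :
    IsNeither (c₀' (m + 1) p (-1)) := by
  have hu : SameClass (c₀' (m + 1) p (-1)) (word x y (periodic
      [(2 * p + 1, 1), (2 * p, 1)] [(p + 1, 1), (2 * p, 1)] m)) :=
    sameClass_periodic 1 (by simp only [word_cons, word_nil]; group)
      (by simp only [word_cons, word_nil]; group)
  refine hu.isNeither_of_spread isBasisPair_x_y (by grind [mem_periodic]) ?_
    (fun e => if e.1 = 2 * p + 1 then 1 else 0) (by rw [sum_map_periodic]; grind)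
  by_cases hp0 : 0 < p
  · exact ⟨(p + 1, 1), by simp [hm], (2 * p + 1, 1), by simp, by grind⟩
  · exact ⟨(2 * p, 1), by simp, (p + 1, 1), by simp [hm], by grind⟩

theorem isNeither_c₀'_succ_neg_one (hq : q ≠ 0) (hq1 : q ≠ 1) (hq2 : q ≠ -1) :
    IsNeither (c₀' (m + 1) (-1) q) := by
  have hu : SameClass (c₀' (m + 1) (-1) q) (word y x⁻¹ (periodic
      [(1, 1), (1, 1), (q + 1, 1)] [(2, 1), (q + 1, 1)] m)) :=
    sameClass_periodic y⁻¹ (by simp only [word_cons, word_nil]; group)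
      (by simp only [word_cons, word_nil]; group)
  refine hu.isNeither_of_spread isBasisPair_x_y.swap.inv_right (by grind [mem_periodic]) ?_
    (fun e => if e.1 = q + 1 then 1 else if e.1 = 2 then -1 else 0)
    (by rw [sum_map_periodic]; grind)
  by_cases hq0 : 0 < q
  · exact ⟨(1, 1), by simp, (q + 1, 1), by simp, by grind⟩
  · exact ⟨(q + 1, 1), by simp, (1, 1), by simp, by grind⟩

theorem isNeither_c₀'_succ_succ_neg_one_zero (hm : m ≠ 0) :
    IsNeither (c₀' (m + 2) (-1) 0) := by
  have hu : SameClass (c₀' (m + 2) (-1) 0) (word (x⁻¹ * y) y (periodic [(5, 1)] [(2, 1)] m)) :=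
    sameClass_periodic (y⁻¹ * x * y⁻¹ * x) (by simp [zpow_ofNat, pow_succ, mul_assoc])
      (by simp [zpow_ofNat, pow_succ, mul_assoc])
  exact hu.isNeither_of_spread isBasisPair_inv_x_mul_y_y (by grind [mem_periodic])
    ⟨(2, 1), by simp [hm], (5, 1), by simp, by grind⟩
    (fun e => if e.1 = 5 then 1 else 0) (by rw [sum_map_periodic]; grind)

theorem isNeither_c₀'_succ_neg_one_one (hm : m ≠ 0) : IsNeither (c₀' (m + 1) (-1) 1) := by
  have hu : SameClass (c₀' (m + 1) (-1) 1)
      (word (x⁻¹ * y) y (periodic [(3, 1)] [(1, 1), (1, 1)] m)) :=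
    sameClass_periodic (y⁻¹ * x) (by simp [zpow_ofNat, pow_succ, mul_assoc])
      (by simp [zpow_ofNat, pow_succ, mul_assoc])
  exact hu.isNeither_of_spread isBasisPair_inv_x_mul_y_y (by grind [mem_periodic])
    ⟨(1, 1), by simp [hm], (3, 1), by simp, by grind⟩
    (fun e => if e.1 = 3 then 1 else 0) (by rw [sum_map_periodic]; grind)

theorem isNeither_c₀'_neg_succ (hp0 : p ≠ 0) (hp1 : p ≠ 1) (hp2 : p ≠ -1) (hq : q ≠ -1)
    (hmpq : ¬ (m = 0 ∧ p = 2 ∧ q = 0)) : IsNeither (c₀' (-(m + 1)) p q) := by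
  have hu : SameClass (c₀' (-(m + 1)) p q) (word x y (periodic
      [(1, 1), (p, q + 1), (p, 1)] [(p + 1, 1), (p, q + 1), (p, 1)] m)) :=
    sameClass_periodic_neg 1 (by simp only [word_cons, word_nil]; group)
      (by simp only [word_cons, word_nil]; group)
  rcases lt_trichotomy q 0 with hq0 | rfl | hq0
  · exact hu.isNeither_of_mixed_snd isBasisPair_x_y (by grind [mem_periodic])
      ⟨(p, 1), by grind [mem_periodic]⟩ ⟨(p, q + 1), by grind [mem_periodic]⟩
      (fun e => if e.1 = 1 then 1 else 0) (by rw [sum_map_periodic]; grind)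
  · refine hu.isNeither_of_spread isBasisPair_x_y (by grind [mem_periodic]) ?_
      (fun e => if e.1 = 1 then 1 else 0) (by rw [sum_map_periodic]; grind)
    by_cases hp3 : p < 0
    · exact ⟨(p, 1), by simp, (1, 1), by simp, by grind⟩
    by_cases hm : m = 0
    · exact ⟨(1, 1), by simp, (p, 1), by simp, by grind⟩
    · exact ⟨(1, 1), by simp, (p + 1, 1), by simp [hm], by grind⟩
  · exact hu.isNeither_of_squares isBasisPair_x_y (by grind [mem_periodic])
      ⟨(p, 1), by grind [mem_periodic]⟩ ⟨(p, q + 1), by grind [mem_periodic]⟩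
      (fun e => if e.1 = 1 then 1 else 0) (by rw [sum_map_periodic]; grind)

theorem isNeither_c₀'_neg_one_one (hq : 2 ≤ q) : IsNeither (c₀' (-1) 1 q) := by
  have hu : SameClass (c₀' (-1) 1 q) (word y x [(1, 1), (q + 1, 1), (1, 1)]) :=
    sameClass_of_mul_eq_inv (x ^ 2) (by simp only [c₀', word_cons, word_nil]; group)
  exact hu.isNeither_of_spread isBasisPair_x_y.swap (by grind)
    ⟨(1, 1), by simp, (q + 1, 1), by simp, by grind⟩
    (fun e => if e.1 = q + 1 then 1 else 0) (by grind)

theorem isNeither_c₀'_neg_succ_one (hq : q ≠ 0) (hq' : q ≠ -1) (hmq : ¬ (m = 0 ∧ q = 1)) :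
    IsNeither (c₀' (-(m + 1)) 1 q) := by
  have hu : SameClass (c₀' (-(m + 1)) 1 q) (word x y (periodic
      [(1, 1), (1, q + 1), (1, 1)] [(2, 1), (1, q + 1), (1, 1)] m)) :=
    sameClass_periodic_neg 1 (by simp only [word_cons, word_nil]; group)
      (by simp only [word_cons, word_nil]; group)
  have hne : ∀ e ∈ periodic [(1, 1), (1, q + 1), (1, 1)] [(2, 1), (1, q + 1), (1, 1)] m,
      e.1 ≠ 0 ∧ e.2 ≠ 0 := by grind [mem_periodic]
  by_cases hq0 : q < 0
  · exact hu.isNeither_of_mixed_snd isBasisPair_x_y hne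
      ⟨(1, 1), by grind [mem_periodic]⟩ ⟨(1, q + 1), by grind [mem_periodic]⟩
      (fun e => if e.2 = q + 1 then 1 else if e.1 = 2 then -1 else 0)
      (by rw [sum_map_periodic]; grind)
  by_cases hm : m = 0
  · subst hm
    simpa using isNeither_c₀'_neg_one_one (by omega)
  · exact hu.isNeither_of_squares isBasisPair_x_y hne
      ⟨(2, 1), by grind [mem_periodic]⟩ ⟨(1, q + 1), by grind [mem_periodic]⟩
      (fun e => if e.2 = q + 1 then 1 else if e.1 = 2 then -1 else 0)
      (by rw [sum_map_periodic]; grind)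

theorem isNeither_c₀'_neg_succ_neg_one_right (hp : p ≠ 0) (hp' : p ≠ 1) :
    IsNeither (c₀' (-(m + 1)) p (-1)) := by
  have hu : SameClass (c₀' (-(m + 1)) p (-1)) (word x y (periodic
      [(1, 1), (2 * p, 1)] [(p + 1, 1), (2 * p, 1)] m)) :=
    sameClass_periodic_neg 1 (by simp only [word_cons, word_nil]; group)
      (by simp only [word_cons, word_nil]; group)
  refine hu.isNeither_of_spread isBasisPair_x_y (by grind [mem_periodic]) ?_
    (fun e => if e.1 = 1 then 1 else 0) (by rw [sum_map_periodic]; grind)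
  by_cases hp0 : 0 < p
  · exact ⟨(1, 1), by simp, (2 * p, 1), by simp, by grind⟩
  · exact ⟨(2 * p, 1), by simp, (1, 1), by simp, by grind⟩

theorem isNeither_c₀'_neg_succ_neg_one (hq : q ≠ -1) : IsNeither (c₀' (-(m + 1)) (-1) q) := by
  have hu : SameClass (c₀' (-(m + 1)) (-1) q) (word x y (periodic
      [(-1, 1), (1, 1), (-1, q + 1)] [(-1, 2), (-1, q + 1)] m)) :=
    sameClass_periodic_neg (y⁻¹ * x) (by simp only [word_cons, word_nil]; group)
      (by simp only [word_cons, word_nil]; group)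
  exact hu.isNeither_of_mixed_fst isBasisPair_x_y (by grind [mem_periodic])
    ⟨(1, 1), by grind [mem_periodic]⟩ ⟨(-1, 1), by grind [mem_periodic]⟩
    (fun e => if e.1 = 1 then 1 else 0) (by rw [sum_map_periodic]; grind)

theorem isNeither_c₀'_neg_succ_succ_one_zero (hm : m ≠ 0) :
    IsNeither (c₀' (-(m + 2)) 1 0) := by
  have hu : SameClass (c₀' (-(m + 2)) 1 0) (word (x * y) x (periodic [(6, 1)] [(3, 1)] m)) :=
    sameClass_periodic_neg (x * y * x * y * x * y)⁻¹ (by simp [zpow_ofNat, pow_succ, mul_assoc])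
      (by simp [zpow_ofNat, pow_succ, mul_assoc])
  exact hu.isNeither_of_spread isBasisPair_x_mul_y_x (by grind [mem_periodic])
    ⟨(3, 1), by simp [hm], (6, 1), by simp, by grind⟩
    (fun e => if e.1 = 6 then 1 else 0) (by rw [sum_map_periodic]; grind)

theorem c₀'_zero : c₀' 0 p q = x ^ p := by rw [c₀', zpow_zero, mul_one]

theorem isPrimitive_c₀'_one_neg_two_zero : IsPrimitive (c₀' 1 (-2) 0) :=
  (sameClass_of_mul_eq 1 (by simp [c₀', zpow_ofNat, pow_succ, mul_assoc])).isPrimitive_iff.2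
    ((isBasisPair_x_y.zpow_mul_right (-2)).inv_left.isPrimitive_mul_zpow 3)

theorem isPrimitive_c₀'_one_neg_one_one : IsPrimitive (c₀' 1 (-1) 1) :=
  (sameClass_of_mul_eq (x⁻¹ * y * x⁻¹)
    (by simp [c₀', zpow_ofNat, pow_succ, mul_assoc])).isPrimitive_iff.2
    ((isBasisPair_x_y.swap.inv_right.zpow_mul_right 1).isPrimitive_mul_zpow 3)

theorem isPrimitive_c₀'_one_neg_one_right : IsPrimitive (c₀' 1 p (-1)) := by
  refine (sameClass_of_mul_eq 1 ?_).isPrimitive_iff.2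
    ((isBasisPair_x_y.zpow_mul_right (2 * p)).isPrimitive_mul_zpow 2)
  simp only [c₀', zpow_ofNat, pow_succ, pow_zero]
  group

theorem isPrimitive_c₀'_neg_one_two_zero : IsPrimitive (c₀' (-1) 2 0) :=
  (sameClass_of_mul_eq_inv (x ^ 2)
    (by simp [c₀', zpow_ofNat, pow_succ, mul_assoc])).isPrimitive_iff.2
    ((isBasisPair_x_y.zpow_mul_right 2).inv_left.isPrimitive_mul_zpow 3)

theorem isPrimitive_c₀'_neg_one_one_one : IsPrimitive (c₀' (-1) 1 1) :=
  (sameClass_of_mul_eq_inv (x ^ 2 * y * x)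
    (by simp [c₀', zpow_ofNat, pow_succ, mul_assoc])).isPrimitive_iff.2
    ((isBasisPair_x_y.swap.zpow_mul_right 1).isPrimitive_mul_zpow 3)

theorem isPrimitive_c₀'_two_neg_one_zero : IsPrimitive (c₀' 2 (-1) 0) :=
  (sameClass_of_mul_eq ((x⁻¹ * y) ^ 3)
    (by simp [c₀', zpow_ofNat, pow_succ, mul_assoc])).isPrimitive_iff.2
    (isBasisPair_inv_x_mul_y_y.swap.isPrimitive_mul_zpow 5)

theorem isPrimitive_c₀'_neg_two_one_zero : IsPrimitive (c₀' (-2) 1 0) :=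
  (sameClass_of_mul_eq_inv (x * (x * y) ^ 3)
    (by simp [c₀', zpow_ofNat, pow_succ, mul_assoc])).isPrimitive_iff.2
    (isBasisPair_x_mul_y_x.swap.isPrimitive_mul_zpow 6)

theorem isPrimitive_c₀'_one_neg_one (n : ℤ) : IsPrimitive (c₀' n 1 (-1)) := by
  have hword : c₀' n 1 (-1) = x * (x ^ (2 : ℤ) * y) ^ (2 * n) := by
    rw [c₀', zpow_mul]
    simp [zpow_ofNat, pow_succ, mul_assoc]
  rw [hword]
  exact (isBasisPair_x_y.zpow_mul_right 2).isPrimitive_mul_zpow (2 * n)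

theorem isPower_c₀'_one_neg_one_zero : IsPower (c₀' 1 (-1) 0) :=
  (sameClass_of_mul_eq 1 (by simp [c₀', pow_succ, mul_assoc])).isPower_iff.2
    ((isBasisPair_x_y.zpow_mul_right (-1)).isPower_right_pow (k := 3) (by norm_num))

theorem isPower_c₀'_neg_one_one_zero : IsPower (c₀' (-1) 1 0) :=
  (sameClass_of_mul_eq_inv x
    (by simp [c₀', zpow_ofNat, pow_succ, mul_assoc])).isPower_iff.2
    ((isBasisPair_x_y.zpow_mul_right 1).isPower_right_pow (k := 3) (by norm_num))

theorem isNeither_c₀'_of_pos (hp : p ≠ 0) (h₁ : ¬ (m = 0 ∧ p = -2 ∧ q = 0))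
    (h₂ : ¬ (m = 0 ∧ p = -1 ∧ (q = 0 ∨ q = 1))) (h₃ : ¬ (m = 0 ∧ q = -1))
    (h₄ : ¬ (m = 1 ∧ p = -1 ∧ q = 0)) (h₅ : ¬ (p = 1 ∧ q = -1)) :
    IsNeither (c₀' (m + 1) p q) := by
  by_cases hq : q = -1
  · subst hq
    exact isNeither_c₀'_succ_neg_one_right m (by omega) hp (by omega)
  by_cases hp' : p = -1
  · subst hp'
    by_cases hq0 : q = 0
    · subst hq0
      obtain ⟨k, rfl⟩ := Nat.exists_eq_succ_of_ne_zero (n := m) (by omega)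
      have h := isNeither_c₀'_succ_succ_neg_one_zero (m := k) (by omega)
      rwa [Nat.cast_succ, add_assoc]
    by_cases hq1 : q = 1
    · exact hq1 ▸ isNeither_c₀'_succ_neg_one_one m (by omega)
    · exact isNeither_c₀'_succ_neg_one m hq0 hq1 hq
  · exact isNeither_c₀'_succ m hp hp' hq h₁

theorem isNeither_c₀'_of_neg (hp : p ≠ 0) (h₁ : ¬ (m = 0 ∧ p = 2 ∧ q = 0))
    (h₂ : ¬ (m = 0 ∧ p = 1 ∧ (q = 0 ∨ q = 1))) (h₃ : ¬ (m = 1 ∧ p = 1 ∧ q = 0))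
    (h₄ : ¬ (p = 1 ∧ q = -1)) : IsNeither (c₀' (-(m + 1)) p q) := by
  by_cases hq : q = -1
  · subst hq
    exact isNeither_c₀'_neg_succ_neg_one_right m hp (by omega)
  by_cases hp' : p = -1
  · exact hp' ▸ isNeither_c₀'_neg_succ_neg_one m hq
  by_cases hp1 : p = 1
  · subst hp1
    by_cases hq0 : q = 0
    · subst hq0
      obtain ⟨k, rfl⟩ := Nat.exists_eq_succ_of_ne_zero (n := m) (by omega)
      have h := isNeither_c₀'_neg_succ_succ_one_zero (m := k) (by omega)
      rwa [Nat.cast_succ, add_assoc]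
    · exact isNeither_c₀'_neg_succ_one m hq0 hq (by omega)
  · exact isNeither_c₀'_neg_succ m hp hp1 hp' hq h₁

theorem classification_c₀' {n : ℤ} (hp : p ≠ 0) :
    (IsPrimitive (c₀' n p q) ↔
      (n = 0 ∧ (p = 1 ∨ p = -1)) ∨ (n = 1 ∧ p = -2 ∧ q = 0) ∨ (n = 1 ∧ p = -1 ∧ q = 1) ∨
      (n = 1 ∧ q = -1) ∨ (n = -1 ∧ p = 2 ∧ q = 0) ∨ (n = -1 ∧ p = 1 ∧ q = 1) ∨
      (n = 2 ∧ p = -1 ∧ q = 0) ∨ (n = -2 ∧ p = 1 ∧ q = 0) ∨ (p = 1 ∧ q = -1)) ∧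
    (IsPower (c₀' n p q) ↔
      (n = 0 ∧ 2 ≤ |p|) ∨ (n = 1 ∧ p = -1 ∧ q = 0) ∨ (n = -1 ∧ p = 1 ∧ q = 0)) := by
  refine isPrimitive_iff_and_isPower_iff ?_ ?_ fun h₁ h₂ => ?_
  · rintro (⟨rfl, h⟩ | ⟨rfl, rfl, rfl⟩ | ⟨rfl, rfl, rfl⟩ | ⟨rfl, rfl⟩ | ⟨rfl, rfl, rfl⟩ |
      ⟨rfl, rfl, rfl⟩ | ⟨rfl, rfl, rfl⟩ | ⟨rfl, rfl, rfl⟩ | ⟨rfl, rfl⟩)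
    exacts [c₀'_zero (q := q) ▸ isPrimitive_x_zpow h, isPrimitive_c₀'_one_neg_two_zero,
      isPrimitive_c₀'_one_neg_one_one, isPrimitive_c₀'_one_neg_one_right,
      isPrimitive_c₀'_neg_one_two_zero, isPrimitive_c₀'_neg_one_one_one,
      isPrimitive_c₀'_two_neg_one_zero, isPrimitive_c₀'_neg_two_one_zero,
      isPrimitive_c₀'_one_neg_one n]
  · rintro (⟨rfl, h⟩ | ⟨rfl, rfl, rfl⟩ | ⟨rfl, rfl, rfl⟩)
    exacts [c₀'_zero (q := q) ▸ isPower_x_zpow h, isPower_c₀'_one_neg_one_zero,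
      isPower_c₀'_neg_one_one_zero]
  · obtain rfl | ⟨m, rfl⟩ | ⟨m, rfl⟩ := eq_zero_or_succ_or_neg_succ n
    · grind
    · exact isNeither_c₀'_of_pos m hp (by omega) (by omega) (by omega) (by omega) (by omega)
    · exact isNeither_c₀'_of_neg m hp (by omega) (by omega) (by omega) (by omega)

end FirstFamily

section SecondFamily

variable (m : ℕ) {p q : ℤ}

theorem isBasisPair_x_inv_x_mul_y : IsBasisPair x (x⁻¹ * y) := by
  simpa using isBasisPair_x_y.zpow_mul_right (-1)

theorem isBasisPair_y_mul_x_y : IsBasisPair (y * x) y := by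
  simpa using (isBasisPair_x_y.swap.zpow_mul_right 1).swap

theorem sameClass_c₀''_succ : SameClass (c₀'' (m + 1) p q) (word x y (periodic
    [(2 * p + 1, 1), (p, q), (p, 1)] [(p, -1), (-p, -1), (p, 1), (p, q), (p, 1)] m)) :=
  sameClass_periodic (x ^ p * y * x ^ (-p)) (by simp only [word_cons, word_nil]; group)
    (by simp only [word_cons, word_nil]; group)

theorem isNeither_c₀''_succ (hm : m ≠ 0) (hp : p ≠ 0) (hp' : p ≠ -1) (hq : q ≠ 0) :
    IsNeither (c₀'' (m + 1) p q) :=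
  (sameClass_c₀''_succ m).isNeither_of_mixed_snd isBasisPair_x_y (by grind [mem_periodic])
    ⟨(p, 1), by simp⟩ ⟨(p, -1), by simp [hm]⟩
    (fun e => if e.1 = 2 * p + 1 then 1 else 0) (by rw [sum_map_periodic]; grind)

theorem isNeither_c₀''_succ_neg_one (hm : m ≠ 0) (hq : q ≠ 0) (hq' : q ≠ 1) :
    IsNeither (c₀'' (m + 1) (-1) q) := by
  refine (sameClass_c₀''_succ m).isNeither_of_mixed_snd isBasisPair_x_y (by grind [mem_periodic])
    ⟨(-1, 1), by simp⟩ ⟨(-1, -1), by simp [hm]⟩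
    (fun e => if e.1 = 1 then if q = -1 then -2 else -1 else if e.2 = q then 1 else 0) ?_
  rw [sum_map_periodic]
  grind

theorem isNeither_c₀''_succ_zero_right (hm : m ≠ 0) (hp : p ≠ 0) :
    IsNeither (c₀'' (m + 1) p 0) := by
  have hu : SameClass (c₀'' (m + 1) p 0) (word x y (periodic
      [(2 * p + 1, 1), (2 * p, 1)] [(p, -1), (-p, -1), (p, 1), (2 * p, 1)] m)) :=
    sameClass_periodic (x ^ p * y * x ^ (-p)) (by simp only [word_cons, word_nil]; group)
      (by simp only [word_cons, word_nil]; group)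
  refine hu.isNeither_of_mixed_snd isBasisPair_x_y (by grind [mem_periodic])
    ⟨(2 * p, 1), by simp⟩ ⟨(p, -1), by simp [hm]⟩
    (fun e => if e.1 = 2 * p + 1 then if p = -1 then 0 else 1
      else if p = -1 ∧ e.1 = 2 * p then 1 else if p = -1 ∧ e.1 = 1 then -1 else 0) ?_
  rw [sum_map_periodic]
  grind

theorem isNeither_c₀''_succ_succ_neg_one_one : IsNeither (c₀'' (m + 2) (-1) 1) := by
  have hu : SameClass (c₀'' (m + 2) (-1) 1) (word x (x⁻¹ * y) (periodic
      [(-1, -2), (-1, 6)] [(-1, -2), (-1, 3)] m)) :=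
    sameClass_periodic (x⁻¹ * y * x * (y⁻¹ * x) ^ 3 * y * x⁻¹ * y * x)
      (by simp [zpow_ofNat, pow_succ, mul_assoc]) (by simp [zpow_ofNat, pow_succ, mul_assoc])
  exact hu.isNeither_of_mixed_snd isBasisPair_x_inv_x_mul_y (by grind [mem_periodic])
    ⟨(-1, 6), by simp⟩ ⟨(-1, -2), by simp⟩
    (fun e => if e.2 = 6 then 1 else 0) (by rw [sum_map_periodic]; grind)

theorem sameClass_c₀''_neg_succ : SameClass (c₀'' (-(m + 1)) p q) (word x y (periodic
    [(-p, -1), (-1, -1), (-p, -1), (p, 1), (p, q), (p, 1), (p, -1)]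
    [(-p, -1), (p, 1), (p, q), (p, 1), (p, -1)] m)) :=
  sameClass_periodic_neg (x ^ p) (by simp only [word_cons, word_nil]; group)
    (by simp only [word_cons, word_nil]; group)

theorem isNeither_c₀''_neg_succ (hp : p ≠ 0) (hp' : p ≠ 1) (hp'' : p ≠ -1) (hq : q ≠ 0) :
    IsNeither (c₀'' (-(m + 1)) p q) :=
  (sameClass_c₀''_neg_succ m).isNeither_of_mixed_snd isBasisPair_x_y (by grind [mem_periodic])
    ⟨(p, 1), by simp⟩ ⟨(p, -1), by simp⟩
    (fun e => if e.1 = -1 then 1 else 0) (by rw [sum_map_periodic]; grind)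

theorem isNeither_c₀''_neg_succ_neg_one (hq : q ≠ 0) (hq' : q ≠ 1) :
    IsNeither (c₀'' (-(m + 1)) (-1) q) := by
  refine (sameClass_c₀''_neg_succ m).isNeither_of_mixed_snd isBasisPair_x_y
    (by grind [mem_periodic]) ⟨(-1, 1), by simp⟩ ⟨(-1, -1), by simp⟩
    (fun e => if e.1 = 1 then if q = -1 then 2 else 1 else if e.2 = q then -1 else 0) ?_
  rw [sum_map_periodic]
  grind

theorem isNeither_c₀''_neg_succ_zero_right (hp : p ≠ 0) (hp' : p ≠ 1) :
    IsNeither (c₀'' (-(m + 1)) p 0) := by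
  have hu : SameClass (c₀'' (-(m + 1)) p 0) (word x y (periodic
      [(-p, -1), (-1, -1), (-p, -1), (p, 1), (2 * p, 1), (p, -1)]
      [(-p, -1), (p, 1), (2 * p, 1), (p, -1)] m)) :=
    sameClass_periodic_neg (x ^ p) (by simp only [word_cons, word_nil]; group)
      (by simp only [word_cons, word_nil]; group)
  refine hu.isNeither_of_mixed_snd isBasisPair_x_y (by grind [mem_periodic])
    ⟨(p, 1), by simp⟩ ⟨(p, -1), by simp⟩
    (fun e => if p = -1 then if e.1 = 1 then 1 else if e.1 = -2 then -1 else 0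
      else if e.1 = -1 then 1 else 0) ?_
  rw [sum_map_periodic]
  grind

theorem isNeither_c₀''_neg_succ_one : IsNeither (c₀'' (-(m + 1)) 1 q) := by
  by_cases hq : q = 1
  · subst hq
    have hu : SameClass (c₀'' (-(m + 1)) 1 1) (word (y * x) y (periodic
        [(-3, -1), (4, -1)] [(-1, -1), (4, -1)] m)) :=
      sameClass_periodic_neg x (by simp [zpow_ofNat, pow_succ, mul_assoc])
        (by simp [zpow_ofNat, pow_succ, mul_assoc])
    exact hu.isNeither_of_mixed_fst isBasisPair_y_mul_x_y (by grind [mem_periodic])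
      ⟨(4, -1), by simp⟩ ⟨(-3, -1), by simp⟩
      (fun e => if e.1 = -3 then 1 else 0) (by rw [sum_map_periodic]; grind)
  · have hu : SameClass (c₀'' (-(m + 1)) 1 q) (word (y * x) y (periodic
        [(-3, -1), (2, q - 1), (2, -1)] [(-1, -1), (2, q - 1), (2, -1)] m)) :=
      sameClass_periodic_neg x
        (by simp [zpow_ofNat, pow_succ, mul_assoc, zpow_sub_one])
        (by simp [zpow_ofNat, pow_succ, mul_assoc, zpow_sub_one])
    exact hu.isNeither_of_mixed_fst isBasisPair_y_mul_x_y (by grind [mem_periodic])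
      ⟨(2, -1), by simp⟩ ⟨(-3, -1), by simp⟩
      (fun e => if e.1 = -3 then 1 else 0) (by rw [sum_map_periodic]; grind)

theorem isNeither_c₀''_neg_succ_neg_one_one : IsNeither (c₀'' (-(m + 1)) (-1) 1) := by
  have hu : SameClass (c₀'' (-(m + 1)) (-1) 1) (word x (x⁻¹ * y) (periodic
      [(-1, -2), (-2, -2), (-1, 3)] [(-1, -2), (-1, 3)] m)) :=
    sameClass_periodic_neg (x⁻¹ * y * x) (by simp [zpow_ofNat, pow_succ, mul_assoc])
      (by simp [zpow_ofNat, pow_succ, mul_assoc])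
  exact hu.isNeither_of_mixed_snd isBasisPair_x_inv_x_mul_y (by grind [mem_periodic])
    ⟨(-1, 3), by simp⟩ ⟨(-1, -2), by simp⟩
    (fun e => if e.1 = -2 then 1 else 0) (by rw [sum_map_periodic]; grind)

theorem c₀''_zero : c₀'' 0 p q = word x y [(p, 1), (1, 1)] := by simp [c₀'', mul_assoc]

theorem isPrimitive_c₀''_zero_two : IsPrimitive (c₀'' 0 2 q) :=
  (sameClass_of_mul_eq 1 (by simp [c₀'', zpow_ofNat, pow_succ, mul_assoc])).isPrimitive_iff.2
    ((isBasisPair_x_y.zpow_mul_right 1).isPrimitive_mul_zpow 2)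

theorem isPower_c₀''_zero_one : IsPower (c₀'' 0 1 q) :=
  (sameClass_of_mul_eq 1 (by simp [c₀'', pow_succ, mul_assoc])).isPower_iff.2
    ((isBasisPair_x_y.zpow_mul_right 1).isPower_right_pow (k := 2) le_rfl)

theorem isNeither_c₀''_zero (hp : p ≠ 1) (hp' : p ≠ 2) (hp0 : p ≠ 0) :
    IsNeither (c₀'' 0 p q) := by
  refine (sameClass_of_mul_eq 1 (by simp [c₀''_zero])).isNeither_of_spread
    (L := [(p, 1), (1, 1)]) isBasisPair_x_y (by simp) ?_
    (fun e => if e.1 = 1 then 1 else 0) (by simp [hp])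
  by_cases hp'' : p < 0
  · exact ⟨(p, 1), by simp, (1, 1), by simp, by grind⟩
  · exact ⟨(1, 1), by simp, (p, 1), by simp, by grind⟩

theorem sameClass_c₀''_one : SameClass (c₀'' 1 p q) (c₀' 1 p (q - 1)) :=
  sameClass_of_mul_eq (x ^ p * y * x ^ (-p)) (by simp only [c₀', c₀'']; group)

theorem isNeither_c₀''_succ_of_ne_zero (hp : p ≠ 0) (hm : m ≠ 0) :
    IsNeither (c₀'' (m + 1) p q) := by
  by_cases hq : q = 0
  · exact hq ▸ isNeither_c₀''_succ_zero_right m hm hp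
  by_cases hp' : p = -1
  · by_cases hq' : q = 1
    · subst hp' hq'
      obtain ⟨k, rfl⟩ := Nat.exists_eq_succ_of_ne_zero hm
      have h := isNeither_c₀''_succ_succ_neg_one_one k
      rwa [Nat.cast_succ, add_assoc]
    · exact hp' ▸ isNeither_c₀''_succ_neg_one m hm hq hq'
  · exact isNeither_c₀''_succ m hm hp hp' hq

theorem isNeither_c₀''_of_neg (hp : p ≠ 0) : IsNeither (c₀'' (-(m + 1)) p q) := by
  by_cases hp1 : p = 1
  · exact hp1 ▸ isNeither_c₀''_neg_succ_one m
  by_cases hq : q = 0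
  · exact hq ▸ isNeither_c₀''_neg_succ_zero_right m hp hp1
  by_cases hp' : p = -1
  · subst hp'
    by_cases hq' : q = 1
    · exact hq' ▸ isNeither_c₀''_neg_succ_neg_one_one m
    · exact isNeither_c₀''_neg_succ_neg_one m hq hq'
  · exact isNeither_c₀''_neg_succ m hp hp1 hp' hq

theorem classification_c₀'' {n : ℤ} (hp : p ≠ 0) :
    (IsPrimitive (c₀'' n p q) ↔ (n = 0 ∧ p = 2) ∨ (n = 1 ∧ q = 0) ∨
      (n = 1 ∧ p = -1 ∧ q = 2) ∨ (n = 1 ∧ p = -2 ∧ q = 1)) ∧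
    (IsPower (c₀'' n p q) ↔ (n = 0 ∧ p = 1) ∨ (n = 1 ∧ p = -1 ∧ q = 1)) := by
  by_cases hn : n = 1
  · subst hn
    have hc := classification_c₀' (n := 1) (q := q - 1) hp
    rw [sameClass_c₀''_one.isPrimitive_iff, sameClass_c₀''_one.isPower_iff, hc.1, hc.2]
    omega
  refine isPrimitive_iff_and_isPower_iff ?_ ?_ fun h₁ h₂ => ?_
  · rintro (⟨rfl, rfl⟩ | h)
    · exact isPrimitive_c₀''_zero_two
    · omega
  · rintro (⟨rfl, rfl⟩ | h)
    · exact isPower_c₀''_zero_one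
    · omega
  · obtain rfl | ⟨m, rfl⟩ | ⟨m, rfl⟩ := eq_zero_or_succ_or_neg_succ n
    · exact isNeither_c₀''_zero (by omega) (by omega) hp
    · exact isNeither_c₀''_succ_of_ne_zero m hp (by omega)
    · exact isNeither_c₀''_of_neg m hp

end SecondFamily

section ThirdFamily

variable (m : ℕ) {p q r : ℤ}

theorem isBasisPair_y_x_zpow (hp : p = 1 ∨ p = -1) : IsBasisPair y (x ^ p) := by
  obtain rfl | rfl := hp
  · simpa using isBasisPair_x_y.swap
  · simpa using isBasisPair_x_y.swap.inv_right

theorem isPrimitive_word_pair_zero : IsPrimitive (word x y [(p, 1), (p, 0)]) := by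
  refine (sameClass_of_mul_eq (x ^ (-p)) ?_).isPrimitive_iff.2
    (isBasisPair_x_y.zpow_mul_right (2 * p)).swap.isPrimitive_left
  simp only [word_cons, word_nil]
  group

theorem isPrimitive_word_pair_two (hp : p = 1 ∨ p = -1) :
    IsPrimitive (word x y [(p, 1), (p, 2)]) := by
  refine (sameClass_of_mul_eq y⁻¹ ?_).isPrimitive_iff.2
    (((isBasisPair_y_x_zpow hp).mul_zpow_right 1).isPrimitive_mul_zpow 2)
  simp only [word_cons, word_nil, zpow_ofNat, pow_two]
  group

theorem isPower_word_pair_one : IsPower (word x y [(p, 1), (p, 1)]) := by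
  refine (sameClass_of_mul_eq 1 ?_).isPower_iff.2
    ((isBasisPair_x_y.zpow_mul_right p).isPower_right_pow (k := 2) le_rfl)
  simp only [word_cons, word_nil, pow_two, zpow_one, mul_one, one_mul, mul_assoc]

theorem isNeither_word_pair (hp : p ≠ 0) (hr : r ≠ 0) (hr' : r ≠ 1)
    (hpr : ¬ ((p = 1 ∨ p = -1) ∧ r = 2)) : IsNeither (word x y [(p, 1), (p, r)]) := by
  have hu : SameClass (word x y [(p, 1), (p, r)]) (word x y [(p, 1), (p, r)]) :=
    sameClass_of_mul_eq 1 (by simp)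
  by_cases hr0 : r < 0
  · exact hu.isNeither_of_mixed_snd isBasisPair_x_y (by simp [hp, hr])
      ⟨(p, 1), by simp⟩ ⟨(p, r), by simp [hr0]⟩
      (fun e => if e.2 = 1 then 1 else 0) (by simp [hr'])
  by_cases hp' : p = 1 ∨ p = -1
  · have hv : SameClass (word x y [(p, 1), (p, r)]) (word y (x ^ p) [(1, 1), (r, 1)]) :=
      sameClass_of_mul_eq (x ^ p) (by simp [mul_assoc])
    exact hv.isNeither_of_spread (isBasisPair_y_x_zpow hp') (by simp)
      ⟨(1, 1), by simp, (r, 1), by simp, by grind⟩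
      (fun e => if e.1 = 1 then 1 else 0) (by simp [hr'])
  · exact hu.isNeither_of_squares isBasisPair_x_y (by simp [hp, hr])
      ⟨(p, 1), by simp, by grind⟩ ⟨(p, r), by simp, by grind⟩
      (fun e => if e.2 = 1 then 1 else 0) (by simp [hr'])

theorem classification_word_pair (hp : p ≠ 0) :
    (IsPrimitive (word x y [(p, 1), (p, r)]) ↔ ((p = 1 ∨ p = -1) ∧ r = 2) ∨ r = 0) ∧
    (IsPower (word x y [(p, 1), (p, r)]) ↔ r = 1) := by
  refine isPrimitive_iff_and_isPower_iff ?_ ?_ fun h₁ h₂ => ?_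
  · rintro (⟨h, rfl⟩ | rfl)
    exacts [isPrimitive_word_pair_two h, isPrimitive_word_pair_zero]
  · rintro rfl
    exact isPower_word_pair_one
  · exact isNeither_word_pair hp (by tauto) h₂ (by tauto)

theorem sameClass_c₁'_zero : SameClass (c₁' 0 p q) (word x y [(p, 1), (p, q - 1)]) :=
  sameClass_of_mul_eq_inv (y ^ q) (by simp only [c₁', word_cons, word_nil]; group)

theorem isNeither_c₁'_succ (hp : p ≠ 0) (hp' : p ≠ -1) (hq : q ≠ -1) :
    IsNeither (c₁' (m + 1) p q) := by
  have hu : SameClass (c₁' (m + 1) p q) (word x y (periodic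
      [(p, 1), (-p, -1), (-p, 1), (p, 1), (p + 1, 1)] [(p, q + 1), (p, 1), (p + 1, 1)] m)) :=
    sameClass_periodic (x ^ (-p)) (by simp only [word_cons, word_nil]; group)
      (by simp only [word_cons, word_nil]; group)
  exact hu.isNeither_of_mixed_snd isBasisPair_x_y (by grind [mem_periodic])
    ⟨(p, 1), by simp⟩ ⟨(-p, -1), by simp⟩
    (fun e => if e.1 = -p ∧ e.2 = -1 then 1 else 0) (by rw [sum_map_periodic]; grind)

theorem isNeither_c₁'_succ_neg_one_right (hp : p ≠ 0) (hp' : p ≠ -1) :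
    IsNeither (c₁' (m + 1) p (-1)) := by
  have hu : SameClass (c₁' (m + 1) p (-1)) (word x y (periodic
      [(p, 1), (-p, -1), (-p, 1), (p, 1), (p + 1, 1)] [(2 * p, 1), (p + 1, 1)] m)) :=
    sameClass_periodic (x ^ (-p)) (by simp only [word_cons, word_nil]; group)
      (by simp only [word_cons, word_nil]; group)
  exact hu.isNeither_of_mixed_snd isBasisPair_x_y (by grind [mem_periodic])
    ⟨(p, 1), by simp⟩ ⟨(-p, -1), by simp⟩
    (fun e => if e.2 = -1 then 1 else 0) (by rw [sum_map_periodic]; grind)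

theorem isNeither_c₁'_succ_neg_one (hq : q ≠ -1) : IsNeither (c₁' (m + 1) (-1) q) := by
  have hu : SameClass (c₁' (m + 1) (-1) q) (word x y (periodic
      [(-1, 1), (1, -1), (1, 1), (-1, 2)] [(-1, q + 1), (-1, 2)] m)) :=
    sameClass_periodic x (by simp [zpow_ofNat, pow_succ, mul_assoc, zpow_add_one])
      (by simp [zpow_ofNat, pow_succ, mul_assoc, zpow_add_one])
  exact hu.isNeither_of_mixed_snd isBasisPair_x_y (by grind [mem_periodic])
    ⟨(-1, 1), by simp⟩ ⟨(1, -1), by simp⟩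
    (fun e => if e.1 = 1 ∧ e.2 = -1 then 1 else 0) (by rw [sum_map_periodic]; grind)

theorem isNeither_c₁'_succ_neg_one_neg_one : IsNeither (c₁' (m + 1) (-1) (-1)) := by
  have hu : SameClass (c₁' (m + 1) (-1) (-1)) (word x y (periodic
      [(-1, 1), (1, -1), (1, 1), (-1, 2)] [(-2, 2)] m)) :=
    sameClass_periodic x (by simp [zpow_ofNat, pow_succ, mul_assoc])
      (by simp [zpow_ofNat, pow_succ, mul_assoc])
  exact hu.isNeither_of_mixed_snd isBasisPair_x_y (by grind [mem_periodic])
    ⟨(-1, 1), by simp⟩ ⟨(1, -1), by simp⟩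
    (fun e => if e.2 = -1 then 1 else 0) (by rw [sum_map_periodic]; grind)

theorem isNeither_c₁'_of_pos (hp : p ≠ 0) : IsNeither (c₁' (m + 1) p q) := by
  by_cases hp' : p = -1 <;> by_cases hq : q = -1
  · exact hp' ▸ hq ▸ isNeither_c₁'_succ_neg_one_neg_one m
  · exact hp' ▸ isNeither_c₁'_succ_neg_one m hq
  · exact hq ▸ isNeither_c₁'_succ_neg_one_right m hp hp'
  · exact isNeither_c₁'_succ m hp hp' hq

theorem isNeither_c₁'_neg_succ (hp : p ≠ 0) (hp' : p ≠ -1) (hq : q ≠ 0) (hq' : q ≠ -1)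
    (hmq : ¬ (m = 0 ∧ q = 1)) : IsNeither (c₁' (-(m + 1)) p q) := by
  have hu : SameClass (c₁' (-(m + 1)) p q) (word x y (periodic
      [(p, q), (p, 1), (p, q), (p, 1), (p + 1, 1)] [(p, q + 1), (p, 1), (p + 1, 1)] m)) :=
    sameClass_periodic_neg (x ^ (-p)) (by simp only [word_cons, word_nil]; group)
      (by simp only [word_cons, word_nil]; group)
  have hne : ∀ e ∈ periodic [(p, q), (p, 1), (p, q), (p, 1), (p + 1, 1)]
      [(p, q + 1), (p, 1), (p + 1, 1)] m, e.1 ≠ 0 ∧ e.2 ≠ 0 := by grind [mem_periodic]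
  by_cases hq0 : q < 0
  · exact hu.isNeither_of_mixed_snd isBasisPair_x_y hne
      ⟨(p, 1), by simp⟩ ⟨(p, q), by simp [hq0]⟩
      (fun e => if e.1 = p + 1 then 1 else if e.2 = q + 1 then -1 else 0)
      (by rw [sum_map_periodic]; grind)
  · refine hu.isNeither_of_squares isBasisPair_x_y hne ?_ ?_
      (fun e => if e.1 = p + 1 then 1 else if e.2 = q + 1 then -1 else 0)
      (by rw [sum_map_periodic]; grind)
    · by_cases hp0 : 0 < p
      · exact ⟨(p + 1, 1), by simp, by grind⟩
      · exact ⟨(p, 1), by simp, by grind⟩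
    · by_cases hq1 : q = 1
      · exact ⟨(p, q + 1), by simp; omega, by grind⟩
      · exact ⟨(p, q), by simp, by grind⟩

theorem isNeither_c₁'_neg_succ_neg_one_right (hp : p ≠ 0) (hp' : p ≠ -1) :
    IsNeither (c₁' (-(m + 1)) p (-1)) := by
  have hu : SameClass (c₁' (-(m + 1)) p (-1)) (word x y (periodic
      [(p, -1), (p, 1), (p, -1), (p, 1), (p + 1, 1)] [(2 * p, 1), (p + 1, 1)] m)) :=
    sameClass_periodic_neg (x ^ (-p)) (by simp only [word_cons, word_nil]; group)
      (by simp only [word_cons, word_nil]; group)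
  refine hu.isNeither_of_mixed_snd isBasisPair_x_y (by grind [mem_periodic])
    ⟨(p, 1), by simp⟩ ⟨(p, -1), by simp⟩
    (fun e => if e.1 = p + 1 then 1 else if p = 1 ∧ e.2 = -1 then -m
      else if e.1 = 2 * p then -1 else 0) ?_
  rw [sum_map_periodic]
  grind

theorem isNeither_c₁'_neg_succ_neg_one (hq : q ≠ 0) (hq' : q ≠ 1) (hmq : ¬ (m = 0 ∧ q = 2)) :
    IsNeither (c₁' (-(m + 1)) (-1) q) := by
  have hu : SameClass (c₁' (-(m + 1)) (-1) q) (word y x⁻¹ (periodic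
      [(q, 1), (1, 1), (q, 1), (2, 1)] [(q + 1, 1), (2, 1)] m)) :=
    sameClass_periodic_neg 1 (by simp [zpow_ofNat, pow_succ, mul_assoc, zpow_one_add, add_comm q])
      (by simp [zpow_ofNat, pow_succ, mul_assoc, zpow_add_one])
  refine hu.isNeither_of_spread isBasisPair_x_y.swap.inv_right (by grind [mem_periodic]) ?_
    (fun e => if e.1 = 1 then 1 else 0) (by rw [sum_map_periodic]; grind)
  by_cases hq0 : q < 0
  · exact ⟨(q, 1), by simp, (1, 1), by simp, by grind⟩
  by_cases hq2 : q = 2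
  · exact ⟨(1, 1), by simp, (q + 1, 1), by simp; omega, by grind⟩
  · exact ⟨(1, 1), by simp, (q, 1), by simp, by grind⟩

theorem isNeither_c₁'_neg_succ_neg_one_one (hm : m ≠ 0) :
    IsNeither (c₁' (-(m + 1)) (-1) 1) := by
  have hu : SameClass (c₁' (-(m + 1)) (-1) 1)
      (word (x⁻¹ * y) y (periodic [(4, 1)] [(1, 1), (1, 1)] m)) :=
    sameClass_periodic_neg x (by simp [zpow_ofNat, pow_succ, mul_assoc])
      (by simp [zpow_ofNat, pow_succ, mul_assoc])
  exact hu.isNeither_of_spread isBasisPair_inv_x_mul_y_y (by grind [mem_periodic])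
    ⟨(1, 1), by simp [hm], (4, 1), by simp, by grind⟩
    (fun e => if e.1 = 4 then 1 else 0) (by rw [sum_map_periodic]; grind)

theorem isNeither_c₁'_neg_one_zero_right (hp : p ≠ 0) (hp' : p ≠ 1) (hp'' : p ≠ 2) :
    IsNeither (c₁' (-1) p 0) := by
  have hu : SameClass (c₁' (-1) p 0) (word x y [(2 * p, 1), (2 * p, 1), (p + 1, 1)]) :=
    sameClass_of_mul_eq_inv (y * x ^ p * y * x ^ (p + 1) * y)
      (by simp only [c₁', word_cons, word_nil]; group)
  refine hu.isNeither_of_spread isBasisPair_x_y (by grind) ?_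
    (fun e => if e.1 = p + 1 then 1 else 0) (by grind)
  by_cases hp0 : p < 0
  · exact ⟨(2 * p, 1), by simp, (p + 1, 1), by simp, by grind⟩
  · exact ⟨(p + 1, 1), by simp, (2 * p, 1), by simp, by grind⟩

theorem isNeither_c₁'_neg_succ_succ_zero_right (hp : p ≠ 0) (hp' : p ≠ 1) :
    IsNeither (c₁' (-(m + 2)) p 0) := by
  have hu : SameClass (c₁' (-(m + 2)) p 0) (word x (x ^ (2 * p) * y) (periodic
      [(-p, 1), (-p, 1), (1 - p, 3), (1 - p, 1)] [(-p, 1), (-p, 1), (1 - p, 1)] m)) :=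
    sameClass_periodic_neg (x ^ p * y * x ^ p * y * x ^ (p + 1) * y * x ^ p)⁻¹
      (by simp only [word_cons, word_nil, zpow_ofNat, pow_succ, pow_zero]; group)
      (by simp only [word_cons, word_nil, zpow_ofNat, pow_succ, pow_zero]; group)
  refine hu.isNeither_of_squares (isBasisPair_x_y.zpow_mul_right _) (by grind [mem_periodic])
    ?_ ⟨(1 - p, 3), by simp⟩ (fun e => if e.2 = 3 then 1 else 0)
    (by rw [sum_map_periodic]; grind)
  by_cases hp0 : p < 0
  · exact ⟨(1 - p, 1), by simp, by grind⟩
  · exact ⟨(-p, 1), by simp, by grind⟩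

theorem isNeither_c₁'_neg_succ_succ_one_zero : IsNeither (c₁' (-(m + 2)) 1 0) := by
  have hu : SameClass (c₁' (-(m + 2)) 1 0) (word (x ^ 2 * y) (x * y) (periodic
      [(4, 2)] [(1, 2)] m)) :=
    sameClass_periodic_neg (x * x * y * x)⁻¹ (by simp [zpow_ofNat, pow_succ, mul_assoc])
      (by simp [zpow_ofNat, pow_succ, mul_assoc])
  have hb : IsBasisPair (x ^ 2 * y) (x * y) := by
    simpa [pow_two, mul_assoc] using ((isBasisPair_x_y.zpow_mul_right 1).swap.mul_zpow_right 1).swap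
  exact hu.isNeither_of_squares hb (by grind [mem_periodic])
    ⟨(4, 2), by simp⟩ ⟨(4, 2), by simp⟩
    (fun e => if e.1 = 4 then 1 else 0) (by rw [sum_map_periodic]; grind)

theorem isPrimitive_c₁'_neg_one_two_zero : IsPrimitive (c₁' (-1) 2 0) :=
  (sameClass_of_mul_eq_inv (y * x ^ 2 * y)
    (by simp [c₁', zpow_ofNat, pow_succ, mul_assoc])).isPrimitive_iff.2
    ((isBasisPair_x_y.zpow_mul_right 4).inv_left.isPrimitive_mul_zpow 3)

theorem isPrimitive_c₁'_neg_one_neg_one_two : IsPrimitive (c₁' (-1) (-1) 2) :=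
  (sameClass_of_mul_eq_inv (y * x * y⁻¹)
    (by simp [c₁', zpow_ofNat, pow_succ, mul_assoc])).isPrimitive_iff.2
    ((isBasisPair_x_y.swap.inv_right.zpow_mul_right 2).inv_left.isPrimitive_mul_zpow 4)

theorem isPrimitive_c₁'_neg_one_one_right : IsPrimitive (c₁' (-1) p 1) := by
  refine (sameClass_of_mul_eq_inv (y ^ 2 * x ^ p * y) ?_).isPrimitive_iff.2
    ((isBasisPair_x_y.zpow_mul_right p).isPrimitive_mul_zpow 5)
  simp [c₁', zpow_ofNat, pow_succ, mul_assoc, zpow_one_add, add_comm p 1]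

theorem isPower_c₁'_neg_one_one_zero : IsPower (c₁' (-1) 1 0) :=
  (sameClass_of_mul_eq_inv (y * x⁻¹)
    (by simp [c₁', zpow_ofNat, pow_succ, mul_assoc])).isPower_iff.2
    ((isBasisPair_x_y.zpow_mul_right 2).isPower_right_pow (k := 3) (by norm_num))

theorem isNeither_c₁'_neg_succ_zero_right (hp : p ≠ 0) (hmp : ¬ (m = 0 ∧ (p = 1 ∨ p = 2))) :
    IsNeither (c₁' (-(m + 1)) p 0) := by
  obtain _ | k := m
  · simpa using isNeither_c₁'_neg_one_zero_right hp (by omega) (by omega)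
  rw [Nat.cast_succ, add_assoc]
  by_cases hp' : p = 1
  · subst hp'
    exact isNeither_c₁'_neg_succ_succ_one_zero k
  · exact isNeither_c₁'_neg_succ_succ_zero_right k hp hp'

theorem isNeither_c₁'_of_neg (hp : p ≠ 0) (h₁ : ¬ (m = 0 ∧ p = 2 ∧ q = 0))
    (h₂ : ¬ (m = 0 ∧ p = -1 ∧ q = 2)) (h₃ : ¬ (m = 0 ∧ q = 1)) (h₄ : ¬ (m = 0 ∧ p = 1 ∧ q = 0)) :
    IsNeither (c₁' (-(m + 1)) p q) := by
  by_cases hq : q = 0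
  · exact hq ▸ isNeither_c₁'_neg_succ_zero_right m hp (by omega)
  by_cases hp' : p = -1
  · subst hp'
    by_cases hq1 : q = 1
    · exact hq1 ▸ isNeither_c₁'_neg_succ_neg_one_one m (by omega)
    · exact isNeither_c₁'_neg_succ_neg_one m hq hq1 (by omega)
  by_cases hq' : q = -1
  · exact hq' ▸ isNeither_c₁'_neg_succ_neg_one_right m hp hp'
  · exact isNeither_c₁'_neg_succ m hp hp' hq hq' h₃

theorem classification_c₁' {n : ℤ} (hp : p ≠ 0) :
    (IsPrimitive (c₁' n p q) ↔ (n = 0 ∧ q = 1) ∨ (n = 0 ∧ (p = 1 ∨ p = -1) ∧ q = 3) ∨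
      (n = -1 ∧ p = 2 ∧ q = 0) ∨ (n = -1 ∧ p = -1 ∧ q = 2) ∨ (n = -1 ∧ q = 1)) ∧
    (IsPower (c₁' n p q) ↔ (n = -1 ∧ p = 1 ∧ q = 0) ∨ (n = 0 ∧ q = 2)) := by
  by_cases hn : n = 0
  · subst hn
    have hc := classification_word_pair (r := q - 1) hp
    rw [sameClass_c₁'_zero.isPrimitive_iff, sameClass_c₁'_zero.isPower_iff, hc.1, hc.2]
    omega
  refine isPrimitive_iff_and_isPower_iff ?_ ?_ fun h₁ h₂ => ?_
  · rintro (h | h | ⟨rfl, rfl, rfl⟩ | ⟨rfl, rfl, rfl⟩ | ⟨rfl, rfl⟩)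
    exacts [absurd h.1 hn, absurd h.1 hn, isPrimitive_c₁'_neg_one_two_zero,
      isPrimitive_c₁'_neg_one_neg_one_two, isPrimitive_c₁'_neg_one_one_right]
  · rintro (⟨rfl, rfl, rfl⟩ | h)
    exacts [isPower_c₁'_neg_one_one_zero, absurd h.1 hn]
  · obtain rfl | ⟨m, rfl⟩ | ⟨m, rfl⟩ := eq_zero_or_succ_or_neg_succ n
    · exact absurd rfl hn
    · exact isNeither_c₁'_of_pos m hp
    · exact isNeither_c₁'_of_neg m hp (by omega) (by omega) (by omega) (by omega)

end ThirdFamily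

section FourthFamily

variable (m : ℕ) {p q : ℤ}

theorem sameClass_c₁''_zero : SameClass (c₁'' 0 p q) (word x y [(p, 1), (p, q)]) :=
  sameClass_of_mul_eq_inv 1 (by simp only [c₁'', word_cons, word_nil]; group)

theorem isNeither_c₁''_succ (hp : p ≠ 0) (hq : q ≠ 0) (hq' : q ≠ 1) :
    IsNeither (c₁'' (m + 1) p q) := by
  have hu : SameClass (c₁'' (m + 1) p q) (word x y (periodic
      [(p, 1), (p, -1), (-p, -1)] [(p, 1), (p, q), (p, 1), (p, -1), (-p, -1)] m)) :=
    sameClass_periodic 1 (by simp only [word_cons, word_nil]; group)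
      (by simp only [word_cons, word_nil]; group)
  refine hu.isNeither_of_mixed_snd isBasisPair_x_y (by grind [mem_periodic])
    ⟨(p, 1), by simp⟩ ⟨(p, -1), by simp⟩
    (fun e => if e.1 = -p then if q = -1 then 2 else 1
      else if e.2 = if q = -1 then 1 else q then -1 else 0) ?_
  rw [sum_map_periodic]
  grind

theorem isNeither_c₁''_succ_zero_right (hp : p ≠ 0) : IsNeither (c₁'' (m + 1) p 0) := by
  have hu : SameClass (c₁'' (m + 1) p 0) (word x y (periodic
      [(p, 1), (p, -1), (-p, -1)] [(p, 1), (2 * p, 1), (p, -1), (-p, -1)] m)) :=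
    sameClass_periodic 1 (by simp only [word_cons, word_nil]; group)
      (by simp only [word_cons, word_nil]; group)
  exact hu.isNeither_of_mixed_snd isBasisPair_x_y (by grind [mem_periodic])
    ⟨(p, 1), by simp⟩ ⟨(p, -1), by simp⟩
    (fun e => if e.1 = -p then 1 else if e.1 = 2 * p then -1 else 0)
    (by rw [sum_map_periodic]; grind)

theorem isNeither_c₁''_succ_one_right (hp : p ≠ 0) : IsNeither (c₁'' (m + 1) p 1) := by
  have hu : SameClass (c₁'' (m + 1) p 1) (word x (x ^ p * y) (periodic
      [(p, -2), (p, 1)] [(p, -2), (p, 3)] m)) :=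
    sameClass_periodic (y * x ^ p * y * x ^ (-p))
      (by simp only [word_cons, word_nil, zpow_neg, zpow_ofNat, pow_succ, pow_zero]; group)
      (by simp only [word_cons, word_nil, zpow_neg, zpow_ofNat, pow_succ, pow_zero]; group)
  exact hu.isNeither_of_mixed_snd (isBasisPair_x_y.zpow_mul_right p) (by grind [mem_periodic])
    ⟨(p, 1), by simp⟩ ⟨(p, -2), by simp⟩
    (fun e => if e.2 = 1 then 1 else 0) (by rw [sum_map_periodic]; grind)

theorem isNeither_c₁''_neg_succ (hp : p ≠ 0) (hq : q ≠ 0) (hq' : q ≠ 1) :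
    IsNeither (c₁'' (-(m + 1)) p q) := by
  have hu : SameClass (c₁'' (-(m + 1)) p q) (word x y (periodic
      [(p, 1), (p, q), (p, 1), (p, q), (p, 1), (p, -1), (-p, -1)]
      [(p, 1), (p, q), (p, 1), (p, -1), (-p, -1)] m)) :=
    sameClass_periodic_neg 1 (by simp only [word_cons, word_nil]; group)
      (by simp only [word_cons, word_nil]; group)
  refine hu.isNeither_of_mixed_snd isBasisPair_x_y (by grind [mem_periodic])
    ⟨(p, 1), by simp⟩ ⟨(p, -1), by simp⟩
    (fun e => if e.1 = -p then if q = -1 then -2 else -1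
      else if e.2 = if q = -1 then 1 else q then 1 else 0) ?_
  rw [sum_map_periodic]
  grind

theorem isNeither_c₁''_neg_succ_zero_right (hp : p ≠ 0) : IsNeither (c₁'' (-(m + 1)) p 0) := by
  have hu : SameClass (c₁'' (-(m + 1)) p 0) (word x y (periodic
      [(p, 1), (2 * p, 1), (2 * p, 1), (p, -1), (-p, -1)]
      [(p, 1), (2 * p, 1), (p, -1), (-p, -1)] m)) :=
    sameClass_periodic_neg 1 (by simp only [word_cons, word_nil]; group)
      (by simp only [word_cons, word_nil]; group)
  exact hu.isNeither_of_mixed_snd isBasisPair_x_y (by grind [mem_periodic])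
    ⟨(p, 1), by simp⟩ ⟨(p, -1), by simp⟩
    (fun e => if e.1 = 2 * p then 1 else if e.1 = -p then -1 else 0)
    (by rw [sum_map_periodic]; grind)

theorem isNeither_c₁''_neg_succ_one_right (hp : p ≠ 0) : IsNeither (c₁'' (-(m + 1)) p 1) := by
  have hu : SameClass (c₁'' (-(m + 1)) p 1) (word x (x ^ p * y) (periodic
      [(p, -2), (p, 5)] [(p, -2), (p, 3)] m)) :=
    sameClass_periodic_neg (y * x ^ p * y * x ^ (-p))
      (by simp only [word_cons, word_nil, zpow_neg, zpow_ofNat, pow_succ, pow_zero]; group)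
      (by simp only [word_cons, word_nil, zpow_neg, zpow_ofNat, pow_succ, pow_zero]; group)
  exact hu.isNeither_of_mixed_snd (isBasisPair_x_y.zpow_mul_right p) (by grind [mem_periodic])
    ⟨(p, 5), by simp⟩ ⟨(p, -2), by simp⟩
    (fun e => if e.2 = 5 then 1 else 0) (by rw [sum_map_periodic]; grind)

theorem isNeither_c₁'' {n : ℤ} (hn : n ≠ 0) (hp : p ≠ 0) : IsNeither (c₁'' n p q) := by
  by_cases hq : q = 0
  · subst hq
    obtain h | ⟨m, rfl⟩ | ⟨m, rfl⟩ := eq_zero_or_succ_or_neg_succ n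
    exacts [absurd h hn, isNeither_c₁''_succ_zero_right m hp,
      isNeither_c₁''_neg_succ_zero_right m hp]
  by_cases hq' : q = 1
  · subst hq'
    obtain h | ⟨m, rfl⟩ | ⟨m, rfl⟩ := eq_zero_or_succ_or_neg_succ n
    exacts [absurd h hn, isNeither_c₁''_succ_one_right m hp, isNeither_c₁''_neg_succ_one_right m hp]
  · obtain h | ⟨m, rfl⟩ | ⟨m, rfl⟩ := eq_zero_or_succ_or_neg_succ n
    exacts [absurd h hn, isNeither_c₁''_succ m hp hq hq', isNeither_c₁''_neg_succ m hp hq hq']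

theorem classification_c₁'' {n : ℤ} (hp : p ≠ 0) :
    (IsPrimitive (c₁'' n p q) ↔
      (n = 0 ∧ (p = 1 ∨ p = -1) ∧ q = 2) ∨ (n = 0 ∧ q = 0)) ∧
    (IsPower (c₁'' n p q) ↔ (n = 0 ∧ q = 1)) := by
  by_cases hn : n = 0
  · subst hn
    have hc := classification_word_pair (r := q) hp
    simpa only [sameClass_c₁''_zero.isPrimitive_iff, sameClass_c₁''_zero.isPower_iff,
      true_and] using hc
  · obtain ⟨hprim, hpow⟩ := isNeither_c₁'' (q := q) hn hp
    simp only [hprim, hpow, hn, false_and, or_self, and_self]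

end FourthFamily

end KleinWords

theorem mainTheorem6 (n p q : ℤ) (hp : p ≠ 0) :
    -- (a)
    (KleinWords.IsPrimitive (KleinWords.c₀' n p q) ↔
      (n = 0 ∧ (p = 1 ∨ p = -1)) ∨
      (n = 1 ∧ p = -2 ∧ q = 0) ∨
      (n = 1 ∧ p = -1 ∧ q = 1) ∨
      (n = 1 ∧ q = -1) ∨
      (n = -1 ∧ p = 2 ∧ q = 0) ∨
      (n = -1 ∧ p = 1 ∧ q = 1) ∨
      (n = 2 ∧ p = -1 ∧ q = 0) ∨
      (n = -2 ∧ p = 1 ∧ q = 0) ∨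
      (p = 1 ∧ q = -1)) ∧
    (KleinWords.IsPower (KleinWords.c₀' n p q) ↔
      (n = 0 ∧ 2 ≤ |p|) ∨
      (n = 1 ∧ p = -1 ∧ q = 0) ∨
      (n = -1 ∧ p = 1 ∧ q = 0)) ∧
    -- (b)
    (KleinWords.IsPrimitive (KleinWords.c₀'' n p q) ↔
      (n = 0 ∧ p = 2) ∨
      (n = 1 ∧ q = 0) ∨
      (n = 1 ∧ p = -1 ∧ q = 2) ∨
      (n = 1 ∧ p = -2 ∧ q = 1)) ∧
    (KleinWords.IsPower (KleinWords.c₀'' n p q) ↔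
      (n = 0 ∧ p = 1) ∨
      (n = 1 ∧ p = -1 ∧ q = 1)) ∧
    -- (c)
    (KleinWords.IsPrimitive (KleinWords.c₁' n p q) ↔
      (n = 0 ∧ q = 1) ∨
      (n = 0 ∧ (p = 1 ∨ p = -1) ∧ q = 3) ∨
      (n = -1 ∧ p = 2 ∧ q = 0) ∨
      (n = -1 ∧ p = -1 ∧ q = 2) ∨
      (n = -1 ∧ q = 1)) ∧
    (KleinWords.IsPower (KleinWords.c₁' n p q) ↔
      (n = -1 ∧ p = 1 ∧ q = 0) ∨
      (n = 0 ∧ q = 2)) ∧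
    -- (d)
    (KleinWords.IsPrimitive (KleinWords.c₁'' n p q) ↔
      (n = 0 ∧ (p = 1 ∨ p = -1) ∧ q = 2) ∨
      (n = 0 ∧ q = 0)) ∧
    (KleinWords.IsPower (KleinWords.c₁'' n p q) ↔
      (n = 0 ∧ q = 1)) := by
  obtain ⟨primitive₀', power₀'⟩ := KleinWords.classification_c₀' (n := n) (q := q) hp
  obtain ⟨primitive₀'', power₀''⟩ := KleinWords.classification_c₀'' (n := n) (q := q) hp
  obtain ⟨primitive₁', power₁'⟩ := KleinWords.classification_c₁' (n := n) (q := q) hp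
  obtain ⟨primitive₁'', power₁''⟩ := KleinWords.classification_c₁'' (n := n) (q := q) hp
  exact ⟨primitive₀', power₀', primitive₀'', power₀'', primitive₁', power₁', primitive₁'', power₁''⟩
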